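/- All spaces are real. A linear operator $u$ from a Banach lattice to a Banach space is *almost Dunford–Pettis* if it maps disjoint weakly null sequences to norm null sequences. An $m$-linear operator on a product of Banach lattices is *separately almost Dunford–Pettis* if every linear operator obtained from it by fixing all variables but one is almost Dunford–Pettis. A Banach space $E$ is *Arens regular* if every bounded linear operator $E\to E^*$ is weakly compact. A Banach lattice has the *positive Schur property* if its positive weakly null sequences are norm null. An $m$-linear operator between Banach lattices is *positive* if it takes nonnegative values at nonnegative arguments; such operators are continuous. For a continuous $m$-linear operator $A\colon E^m\to F$ between Banach spaces and a permutation $\rho$ of $\{1,\dots,m\}$, the *Aron–Berner extension* $AB_m^\rho(A)\colon (E^{**})^m\to F^{**}$ is the $m$-linear operator whose value at $(x_1^{**},\dots,x_m^{**})$ is the functional on $F^*$ that sends $y^*$ to the number obtained from the $m$-linear form $y^*\circ A$ by applying $x^{**}_{\rho(1)}$ to it in the variable of index $\rho(1)$ (the other variables being fixed), then applying $x^{**}_{\rho(2)}$ to the resulting $(m-1)$-linear form in the variable of index $\rho(2)$, and so on up to $x^{**}_{\rho(m)}$. **Corollary.** Let $E$ and $F$ be Banach lattices such that $E$ is Arens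 regular, $E^*$ has the positive Schur property, $F$ has order continuous norm, and every bounded linear operator from $E$ to $F$ is weakly compact. Then, for every $m\in\mathbb N$, every positive $m$-linear operator $A\colon E^m\to F$ and every permutation $\rho$ of $\{1,\dots,m\}$, the Aron–Berner extension $AB_m^\rho(A)$ is separately almost Dunford–Pettis. The hypotheses hold for $E=c_0$ and $F=\ell_1$ with their coordinatewise orders; hence, for every $m$, all Aron–Berner extensions of every positive $m$-linear operator $c_0^m\to\ell_1$ are separately almost Dunford–Pettis. -/

import Mathlib

open Filter Topology
open scoped ZeroAtInfty

universe u v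

set_option maxSynthPendingDepth 3
set_option linter.unusedSectionVars false
set_option linter.unusedVariables false

namespace BanachLattice

/-! ### The dual of a Banach lattice, as a Banach lattice -/

section Dual

variable {E : Type*} [NormedAddCommGroup E] [NormedSpace ℝ E] [Lattice E] [HasSolidNorm E]
  [IsOrderedAddMonoid E]

/-- The order of the dual: `f ≤ g` iff `f x ≤ g x` for all `x ≥ 0`. -/
instance dualPartialOrder : PartialOrder (StrongDual ℝ E) where
  le f g := ∀ x : E, 0 ≤ x → f x ≤ g x
  le_refl _ _ _ := le_rfl
  le_trans _ _ _ hfg hgh x hx := (hfg x hx).trans (hgh x hx)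
  le_antisymm f g hfg hgf := by
    ext x
    have key : ∀ y : E, 0 ≤ y → f y = g y := fun y hy => le_antisymm (hfg y hy) (hgf y hy)
    rw [← posPart_sub_negPart x, map_sub, map_sub, key _ (posPart_nonneg x),
      key _ (negPart_nonneg x)]

theorem dual_le_iff {f g : StrongDual ℝ E} : f ≤ g ↔ ∀ x : E, 0 ≤ x → f x ≤ g x := Iff.rfl

theorem norm_le_of_nonneg_of_le {x y : E} (hx : 0 ≤ x) (hxy : x ≤ y) : ‖x‖ ≤ ‖y‖ :=
  norm_le_norm_of_abs_le_abs (by rwa [abs_of_nonneg hx, abs_of_nonneg (hx.trans hxy)])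

/-- The Riesz-Kantorovich formula for the positive part of `f`, at `x ≥ 0`. -/
noncomputable def posFun (f : StrongDual ℝ E) (x : E) : ℝ :=
  sSup (f '' Set.Icc 0 x)

theorem apply_le_of_mem_Icc (f : StrongDual ℝ E) {x y : E} (hy : y ∈ Set.Icc 0 x) :
    f y ≤ ‖f‖ * ‖x‖ :=
  calc f y ≤ ‖f y‖ := le_abs_self _
    _ ≤ ‖f‖ * ‖y‖ := f.le_opNorm y
    _ ≤ ‖f‖ * ‖x‖ :=
        mul_le_mul_of_nonneg_left (norm_le_of_nonneg_of_le hy.1 hy.2) (norm_nonneg _)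

theorem posFun_bddAbove (f : StrongDual ℝ E) (x : E) : BddAbove (f '' Set.Icc 0 x) := by
  refine ⟨‖f‖ * ‖x‖, ?_⟩
  rintro _ ⟨y, hy, rfl⟩
  exact apply_le_of_mem_Icc f hy

theorem le_posFun (f : StrongDual ℝ E) {x y : E} (h0 : 0 ≤ y) (hy : y ≤ x) : f y ≤ posFun f x :=
  le_csSup (posFun_bddAbove f x) ⟨y, ⟨h0, hy⟩, rfl⟩

theorem posFun_le (f : StrongDual ℝ E) {x : E} (hx : 0 ≤ x) {c : ℝ}
    (h : ∀ y, 0 ≤ y → y ≤ x → f y ≤ c) : posFun f x ≤ c := by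
  refine csSup_le ⟨f 0, 0, ⟨le_rfl, hx⟩, rfl⟩ ?_
  rintro _ ⟨y, hy, rfl⟩
  exact h y hy.1 hy.2

theorem posFun_add (f : StrongDual ℝ E) {x y : E} (hx : 0 ≤ x) (hy : 0 ≤ y) :
    posFun f (x + y) = posFun f x + posFun f y := by
  apply le_antisymm
  · refine posFun_le f (add_nonneg hx hy) fun z hz hzxy => ?_
    have h1 : 0 ≤ z ⊓ x := le_inf hz hx
    have h2 : 0 ≤ z - z ⊓ x := sub_nonneg.2 inf_le_left
    have h3 : z - z ⊓ x ≤ y := by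
      rw [sub_le_iff_le_add', ← sub_le_iff_le_add]
      refine le_inf ?_ ?_
      · exact sub_le_self z hy
      · rwa [sub_le_iff_le_add]
    have : f z = f (z ⊓ x) + f (z - z ⊓ x) := by rw [map_sub]; ring
    rw [this]
    exact add_le_add (le_posFun f h1 inf_le_right) (le_posFun f h2 h3)
  · rw [← le_sub_iff_add_le]
    refine posFun_le f hx fun u hu hux => ?_
    rw [le_sub_comm]
    refine posFun_le f hy fun v hv hvy => ?_
    have := le_posFun f (add_nonneg hu hv) (add_le_add hux hvy)
    rw [map_add] at this
    linarith

theorem posFun_nonneg (f : StrongDual ℝ E) {x : E} (hx : 0 ≤ x) : 0 ≤ posFun f x := by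
  simpa using le_posFun f le_rfl hx

theorem posFun_le_norm (f : StrongDual ℝ E) {x : E} (hx : 0 ≤ x) : posFun f x ≤ ‖f‖ * ‖x‖ :=
  posFun_le f hx fun _ h0 h1 => apply_le_of_mem_Icc f ⟨h0, h1⟩

/-- The extension of `posFun f` to an additive map on `E`. -/
noncomputable def posHom (f : StrongDual ℝ E) : E →+ ℝ where
  toFun x := posFun f x⁺ - posFun f x⁻
  map_zero' := by simp
  map_add' x y := by
    have h : (x + y)⁺ + (x⁻ + y⁻) = (x⁺ + y⁺) + (x + y)⁻ := by
      have h1 := posPart_sub_negPart (x + y)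
      have h2 := posPart_sub_negPart x
      have h3 := posPart_sub_negPart y
      have : (x + y)⁺ - (x + y)⁻ = (x⁺ - x⁻) + (y⁺ - y⁻) := by rw [h1, h2, h3]
      have h4 : (x + y)⁺ = (x⁺ - x⁻) + (y⁺ - y⁻) + (x + y)⁻ := by rw [← this]; abel
      rw [h4]; abel
    have h' := congrArg (posFun f) h
    have a1 := posPart_nonneg x
    have a2 := negPart_nonneg x
    have b1 := posPart_nonneg y
    have b2 := negPart_nonneg y
    rw [posFun_add f (posPart_nonneg _) (add_nonneg a2 b2), posFun_add f a2 b2,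
      posFun_add f (add_nonneg a1 b1) (negPart_nonneg _), posFun_add f a1 b1] at h'
    linarith

theorem posHom_apply_of_nonneg (f : StrongDual ℝ E) {x : E} (hx : 0 ≤ x) :
    posHom f x = posFun f x := by
  have h0 : posFun f (0 : E) = 0 := by simp [posFun]
  change posFun f x⁺ - posFun f x⁻ = posFun f x
  rw [posPart_of_nonneg hx, negPart_of_nonneg hx, h0, sub_zero]

theorem posHom_continuous (f : StrongDual ℝ E) : Continuous (posHom f) := by
  refine AddMonoidHomClass.continuous_of_bound (posHom f) ‖f‖ fun x => ?_
  have hp : ‖x⁺‖ ≤ ‖x‖ := by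
    refine norm_le_norm_of_abs_le_abs ?_
    rw [abs_of_nonneg (posPart_nonneg x), ← posPart_add_negPart x]
    exact le_add_of_nonneg_right (negPart_nonneg x)
  have hn : ‖x⁻‖ ≤ ‖x‖ := by
    refine norm_le_norm_of_abs_le_abs ?_
    rw [abs_of_nonneg (negPart_nonneg x), ← posPart_add_negPart x]
    exact le_add_of_nonneg_left (posPart_nonneg x)
  have h1 := posFun_nonneg f (posPart_nonneg x)
  have h2 := posFun_nonneg f (negPart_nonneg x)
  have h3 := (posFun_le_norm f (posPart_nonneg x)).trans
    (mul_le_mul_of_nonneg_left hp (norm_nonneg f))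
  have h4 := (posFun_le_norm f (negPart_nonneg x)).trans
    (mul_le_mul_of_nonneg_left hn (norm_nonneg f))
  change |posFun f x⁺ - posFun f x⁻| ≤ _
  rw [abs_le]
  constructor <;> linarith

/-- The positive part of `f` in the dual of `E`. -/
noncomputable def dualPos (f : StrongDual ℝ E) : StrongDual ℝ E :=
  (posHom f).toRealLinearMap (posHom_continuous f)

theorem dualPos_apply (f : StrongDual ℝ E) {x : E} (hx : 0 ≤ x) :
    dualPos f x = sSup (f '' Set.Icc 0 x) :=
  posHom_apply_of_nonneg f hx

theorem le_dualPos (f : StrongDual ℝ E) : f ≤ dualPos f := fun x hx => by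
  rw [dualPos_apply f hx]; exact le_posFun f hx le_rfl

theorem dualPos_nonneg (f : StrongDual ℝ E) : 0 ≤ dualPos f := fun x hx => by
  rw [dualPos_apply f hx]; exact posFun_nonneg f hx

theorem dualPos_le {f g : StrongDual ℝ E} (hfg : f ≤ g) (hg : 0 ≤ g) : dualPos f ≤ g :=
  fun x hx => by
    rw [dualPos_apply f hx]
    refine posFun_le f hx fun y hy hyx => (hfg y hy).trans ?_
    have := hg (x - y) (sub_nonneg.2 hyx)
    rw [map_sub] at this
    simpa using this

instance dualIsOrderedAddMonoid : IsOrderedAddMonoid (StrongDual ℝ E) where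
  add_le_add_left f g h k x hx := by
    have := h x hx
    simpa using this

/-- The dual is a lattice: `f ⊔ g = g + (f - g)⁺`, with positive parts given by the
Riesz-Kantorovich formula, and `f ⊓ g = f - (f - g)⁺`. -/
noncomputable instance dualLattice : Lattice (StrongDual ℝ E) where
  sup f g := g + dualPos (f - g)
  le_sup_left f g := by
    have := le_dualPos (f - g)
    rwa [sub_le_iff_le_add'] at this
  le_sup_right f g := le_add_of_nonneg_right (dualPos_nonneg _)
  sup_le f g h hf hg := by
    rw [← le_sub_iff_add_le']
    exact dualPos_le (sub_le_sub_right hf g) (sub_nonneg.2 hg)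
  inf f g := f - dualPos (f - g)
  inf_le_left f g := sub_le_self _ (dualPos_nonneg _)
  inf_le_right f g := sub_le_comm.1 (le_dualPos _)
  le_inf h f g hf hg := by
    rw [le_sub_comm]
    exact dualPos_le (sub_le_sub_left hg f) (sub_nonneg.2 hf)

theorem dual_abs_apply (f : StrongDual ℝ E) : |f| = -f + dualPos (f - -f) := rfl

theorem abs_apply_le (f : StrongDual ℝ E) (x : E) : |f x| ≤ |f| |x| := by
  have h1 := le_abs_self f
  have h2 := neg_le_abs f
  have hp := posPart_nonneg x
  have hn := negPart_nonneg x
  have a1 := h1 _ hp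
  have a2 := h1 _ hn
  have b1 := h2 _ hp
  have b2 := h2 _ hn
  have e1 : f x = f x⁺ - f x⁻ := by rw [← map_sub, posPart_sub_negPart]
  have e2 : |f| |x| = |f| x⁺ + |f| x⁻ := by rw [← map_add, posPart_add_negPart]
  rw [neg_apply] at b1 b2
  rw [e1, e2, abs_le]
  constructor <;> linarith

theorem dual_abs_le_norm (f : StrongDual ℝ E) {x : E} (hx : 0 ≤ x) : |f| x ≤ ‖f‖ * ‖x‖ := by
  rw [dual_abs_apply, add_apply, dualPos_apply _ hx,
    neg_apply, neg_add_le_iff_le_add]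
  refine posFun_le _ hx fun y hy hyx => ?_
  have h1 : ‖(y - x) + y‖ ≤ ‖x‖ := by
    refine norm_le_norm_of_abs_le_abs ?_
    rw [abs_of_nonneg hx]
    refine abs_le'.2 ⟨?_, neg_le.1 ?_⟩
    · exact (add_le_of_nonpos_left (sub_nonpos.2 hyx)).trans hyx
    · have : -x ≤ y - x := by
        rw [neg_le_sub_iff_le_add]; exact le_add_of_nonneg_left hy
      exact this.trans (le_add_of_nonneg_right hy)
  have h2 : f ((y - x) + y) ≤ ‖f‖ * ‖x‖ :=
    (le_abs_self _).trans ((f.le_opNorm _).trans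
      (mul_le_mul_of_nonneg_left h1 (norm_nonneg f)))
  rw [map_add, map_sub] at h2
  simp only [sub_apply, neg_apply]
  linarith

instance dualHasSolidNorm : HasSolidNorm (StrongDual ℝ E) where
  solid f g h := by
    refine f.opNorm_le_bound (norm_nonneg g) fun x => ?_
    calc ‖f x‖ = |f x| := rfl
      _ ≤ |f| |x| := abs_apply_le f x
      _ ≤ |g| |x| := h _ (abs_nonneg x)
      _ ≤ ‖g‖ * ‖|x|‖ := dual_abs_le_norm g (abs_nonneg x)
      _ = ‖g‖ * ‖x‖ := by rw [norm_abs_eq_norm]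

instance dualIsOrderedModule : IsOrderedModule ℝ (StrongDual ℝ E) where
  smul_le_smul_of_nonneg_left c hc f g h x hx := by
    simpa using mul_le_mul_of_nonneg_left (h x hx) hc
  smul_le_smul_of_nonneg_right f hf c d h x hx := by
    simpa using mul_le_mul_of_nonneg_right h (hf x hx)

end Dual

/-! ### The Banach lattices `c₀` and `ℓ₁`, with the coordinatewise order -/

section SequenceSpaces

instance cZeroPartialOrder : PartialOrder C₀(ℕ, ℝ) :=
  PartialOrder.lift (fun f => (f : ℕ → ℝ)) DFunLike.coe_injective

instance cZeroLattice : Lattice C₀(ℕ, ℝ) where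
  sup f g :=
    { toFun := fun n => f n ⊔ g n
      continuous_toFun := continuous_of_discreteTopology
      zero_at_infty' := by simpa using (zero_at_infty f).sup_nhds (zero_at_infty g) }
  inf f g :=
    { toFun := fun n => f n ⊓ g n
      continuous_toFun := continuous_of_discreteTopology
      zero_at_infty' := by simpa using (zero_at_infty f).inf_nhds (zero_at_infty g) }
  le_sup_left f g n := le_sup_left (a := f n) (b := g n)
  le_sup_right f g n := le_sup_right (a := f n) (b := g n)
  sup_le f g h hf hg n := sup_le (hf n) (hg n)
  inf_le_left f g n := inf_le_left (a := f n) (b := g n)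
  inf_le_right f g n := inf_le_right (a := f n) (b := g n)
  le_inf h f g hf hg n := le_inf (hf n) (hg n)

instance cZeroIsOrderedAddMonoid : IsOrderedAddMonoid C₀(ℕ, ℝ) where
  add_le_add_left f g h k n := by
    have : f n ≤ g n := h n
    change f n + k n ≤ g n + k n
    linarith

instance cZeroIsOrderedModule : IsOrderedModule ℝ C₀(ℕ, ℝ) where
  smul_le_smul_of_nonneg_left c hc f g h n := mul_le_mul_of_nonneg_left (h n) hc
  smul_le_smul_of_nonneg_right f hf c d h n := mul_le_mul_of_nonneg_right h (hf n)

instance cZeroHasSolidNorm : HasSolidNorm C₀(ℕ, ℝ) where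
  solid f g h := by
    rw [← ZeroAtInftyContinuousMap.norm_toBCF_eq_norm,
      ← ZeroAtInftyContinuousMap.norm_toBCF_eq_norm,
      BoundedContinuousFunction.norm_le (norm_nonneg _)]
    intro n
    have h1 : |f n| ≤ |g n| := h n
    exact h1.trans (g.toBCF.norm_coe_le_norm n)

instance lOnePartialOrder : PartialOrder (lp (fun _ : ℕ => ℝ) 1) :=
  PartialOrder.lift (fun f => (f : ℕ → ℝ)) fun _ _ h => lp.ext h

theorem memlp_one_iff {f : ℕ → ℝ} :
    Memℓp f 1 ↔ Summable fun n => |f n| := by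
  rw [memℓp_gen_iff (by simp)]
  simp

noncomputable instance lOneLattice : Lattice (lp (fun _ : ℕ => ℝ) 1) where
  sup f g := ⟨fun n => f n ⊔ g n, by
    refine memlp_one_iff.2 (Summable.of_nonneg_of_le (fun _ => abs_nonneg _) (fun n => ?_)
      ((memlp_one_iff.1 f.2).add (memlp_one_iff.1 g.2)))
    exact abs_max_le_max_abs_abs.trans (max_le_add_of_nonneg (abs_nonneg _) (abs_nonneg _))⟩
  inf f g := ⟨fun n => f n ⊓ g n, by
    refine memlp_one_iff.2 (Summable.of_nonneg_of_le (fun _ => abs_nonneg _) (fun n => ?_)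
      ((memlp_one_iff.1 f.2).add (memlp_one_iff.1 g.2)))
    exact abs_min_le_max_abs_abs.trans (max_le_add_of_nonneg (abs_nonneg _) (abs_nonneg _))⟩
  le_sup_left f g n := le_sup_left (a := f n) (b := g n)
  le_sup_right f g n := le_sup_right (a := f n) (b := g n)
  sup_le f g h hf hg n := sup_le (hf n) (hg n)
  inf_le_left f g n := inf_le_left (a := f n) (b := g n)
  inf_le_right f g n := inf_le_right (a := f n) (b := g n)
  le_inf h f g hf hg n := le_inf (hf n) (hg n)

instance lOneIsOrderedAddMonoid : IsOrderedAddMonoid (lp (fun _ : ℕ => ℝ) 1) where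
  add_le_add_left f g h k n := by
    have : f n ≤ g n := h n
    change f n + k n ≤ g n + k n
    linarith

instance lOneIsOrderedModule : IsOrderedModule ℝ (lp (fun _ : ℕ => ℝ) 1) where
  smul_le_smul_of_nonneg_left c hc f g h n := mul_le_mul_of_nonneg_left (h n) hc
  smul_le_smul_of_nonneg_right f hf c d h n := mul_le_mul_of_nonneg_right h (hf n)

instance lOneHasSolidNorm : HasSolidNorm (lp (fun _ : ℕ => ℝ) 1) where
  solid f g h := by
    rw [lp.norm_eq_tsum_rpow (by simp), lp.norm_eq_tsum_rpow (by simp)]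
    simp only [ENNReal.toReal_one, Real.rpow_one, div_one]
    exact (memlp_one_iff.1 f.2).tsum_le_tsum (fun n => h n) (memlp_one_iff.1 g.2)

end SequenceSpaces

/-! ### Properties of operators and of Banach lattices -/

section Properties

/-- The sequence `x` converges weakly to `0`. -/
def WeaklyNull {G : Type*} [NormedAddCommGroup G] [NormedSpace ℝ G] (x : ℕ → G) : Prop :=
  ∀ φ : StrongDual ℝ G, Tendsto (fun n => φ (x n)) atTop (𝓝 0)

/-- The terms of the sequence `x` are pairwise disjoint. -/
def DisjointSeq {E : Type*} [AddCommGroup E] [Lattice E] (x : ℕ → E) : Prop :=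
  Pairwise fun i j => |x i| ⊓ |x j| = 0

/-- `T` is weakly compact: the image of the closed unit ball is relatively weakly compact. -/
def IsWeaklyCompactOp {G H : Type*} [NormedAddCommGroup G] [NormedSpace ℝ G]
    [NormedAddCommGroup H] [NormedSpace ℝ H] (T : G →L[ℝ] H) : Prop :=
  IsCompact (closure ((fun x => toWeakSpace ℝ H (T x)) '' Metric.closedBall (0 : G) 1))

/-- `G` is Arens regular: every bounded linear operator `G → G*` is weakly compact. -/
def ArensRegular (G : Type*) [NormedAddCommGroup G] [NormedSpace ℝ G] : Prop :=
  ∀ T : G →L[ℝ] StrongDual ℝ G, IsWeaklyCompactOp T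

/-- Positive weakly null sequences are norm null. -/
def PositiveSchur (E : Type*) [NormedAddCommGroup E] [NormedSpace ℝ E] [Lattice E] : Prop :=
  ∀ x : ℕ → E, (∀ n, 0 ≤ x n) → WeaklyNull x → Tendsto (fun n => ‖x n‖) atTop (𝓝 0)

/-- The norm is order continuous: every set directed downwards to `0`, regarded as a decreasing
net indexed by itself, converges to `0` in norm. -/
def OrderContinuousNorm (E : Type*) [NormedAddCommGroup E] [Lattice E] : Prop :=
  ∀ S : Set E, S.Nonempty → DirectedOn (· ≥ ·) S → IsGLB S 0 →
    Tendsto (fun x : S => ‖(x : E)‖) atBot (𝓝 0)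

/-- A linear operator from a Banach lattice to a Banach space is almost Dunford-Pettis if it
maps disjoint weakly null sequences to norm null sequences. -/
def AlmostDunfordPettis {E G : Type*} [NormedAddCommGroup E] [NormedSpace ℝ E] [Lattice E]
    [NormedAddCommGroup G] [NormedSpace ℝ G] (u : E →ₗ[ℝ] G) : Prop :=
  ∀ x : ℕ → E, DisjointSeq x → WeaklyNull x → Tendsto (fun n => ‖u (x n)‖) atTop (𝓝 0)

/-- All the linear operators obtained from `A` by fixing all the variables but one are almost
Dunford-Pettis; `A.toLinearMap x j` is the map `z ↦ A (x₁, …, xⱼ₋₁, z, xⱼ₊₁, …, xₘ)`. -/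
def SeparatelyAlmostDunfordPettis {m : ℕ} {E G : Type*} [NormedAddCommGroup E] [NormedSpace ℝ E]
    [Lattice E] [NormedAddCommGroup G] [NormedSpace ℝ G]
    (A : MultilinearMap ℝ (fun _ : Fin m => E) G) : Prop :=
  ∀ (j : Fin m) (x : Fin m → E), AlmostDunfordPettis (A.toLinearMap x j)

/-- `A` is positive: it takes nonnegative values at nonnegative arguments. -/
def PositiveMultilinear {m : ℕ} {E F : Type*} [NormedAddCommGroup E] [NormedSpace ℝ E]
    [Lattice E] [NormedAddCommGroup F] [NormedSpace ℝ F] [Lattice F]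
    (A : MultilinearMap ℝ (fun _ : Fin m => E) F) : Prop :=
  ∀ x : Fin m → E, (∀ i, 0 ≤ x i) → 0 ≤ A x

end Properties

/-! ### Aron-Berner extensions -/

section AronBerner

variable {E F : Type*} [NormedAddCommGroup E] [NormedSpace ℝ E]
  [NormedAddCommGroup F] [NormedSpace ℝ F]

/-- For a `(k+1)`-linear form `C` and `φ` in the bidual, `evalFirst k C φ` is the `k`-linear form
`(x₁, …, xₖ) ↦ φ (C (•, x₁, …, xₖ))`. It depends linearly on `C` and on `φ`. -/
noncomputable def evalFirst (k : ℕ) :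
    ContinuousMultilinearMap ℝ (fun _ : Fin (k + 1) => E) ℝ →L[ℝ]
      StrongDual ℝ (StrongDual ℝ E) →L[ℝ] ContinuousMultilinearMap ℝ (fun _ : Fin k => E) ℝ :=
  ((ContinuousLinearMap.compContinuousMultilinearMapL ℝ (fun _ : Fin k => E)
      (StrongDual ℝ E) ℝ).flip).comp
    (((ContinuousLinearMap.flipMultilinearEquiv ℝ (fun _ : Fin k => E) E ℝ :
        (E →L[ℝ] ContinuousMultilinearMap ℝ (fun _ : Fin k => E) ℝ) →L[ℝ]
          ContinuousMultilinearMap ℝ (fun _ : Fin k => E) (StrongDual ℝ E))).comp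
      (continuousMultilinearCurryLeftEquiv ℝ (fun _ : Fin (k + 1) => E)
        ℝ).toContinuousLinearEquiv.toContinuousLinearMap)

/-- `C (•, x₁, …, xₖ)` as an element of the dual. -/
noncomputable def firstSlice {k : ℕ} (C : ContinuousMultilinearMap ℝ (fun _ : Fin (k + 1) => E) ℝ)
    (x : Fin k → E) : StrongDual ℝ E :=
  C.curryLeft.flipMultilinear x

theorem firstSlice_apply {k : ℕ} (C : ContinuousMultilinearMap ℝ (fun _ : Fin (k + 1) => E) ℝ)
    (x : Fin k → E) (e : E) : firstSlice C x e = C (Fin.cons e x) := rfl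

theorem evalFirst_apply {k : ℕ} (C : ContinuousMultilinearMap ℝ (fun _ : Fin (k + 1) => E) ℝ)
    (φ : StrongDual ℝ (StrongDual ℝ E)) (x : Fin k → E) :
    evalFirst (E := E) k C φ x = φ (firstSlice C x) := rfl

/-- The extension of `m`-linear forms to the bidual, the variables being treated one after the
other from the first to the last. -/
noncomputable def formExt : (m : ℕ) →
    ContinuousMultilinearMap ℝ (fun _ : Fin m => E) ℝ →L[ℝ]
      ContinuousMultilinearMap ℝ (fun _ : Fin m => StrongDual ℝ (StrongDual ℝ E)) ℝ
  | 0 =>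
    ((continuousMultilinearCurryFin0 ℝ (StrongDual ℝ (StrongDual ℝ E))
        ℝ).symm.toContinuousLinearEquiv.toContinuousLinearMap).comp
      (continuousMultilinearCurryFin0 ℝ E ℝ).toContinuousLinearEquiv.toContinuousLinearMap
  | k + 1 =>
    ((continuousMultilinearCurryLeftEquiv ℝ
        (fun _ : Fin (k + 1) => StrongDual ℝ (StrongDual ℝ E))
        ℝ).symm.toContinuousLinearEquiv.toContinuousLinearMap).comp
      ((ContinuousLinearMap.compL ℝ (StrongDual ℝ (StrongDual ℝ E))
        (ContinuousMultilinearMap ℝ (fun _ : Fin k => E) ℝ)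
        (ContinuousMultilinearMap ℝ (fun _ : Fin k => StrongDual ℝ (StrongDual ℝ E)) ℝ)
        (formExt k)).comp (evalFirst k))

theorem formExt_zero (C : ContinuousMultilinearMap ℝ (fun _ : Fin 0 => E) ℝ)
    (φ : Fin 0 → StrongDual ℝ (StrongDual ℝ E)) : formExt 0 C φ = C 0 := rfl

theorem formExt_succ {k : ℕ} (C : ContinuousMultilinearMap ℝ (fun _ : Fin (k + 1) => E) ℝ)
    (φ : Fin (k + 1) → StrongDual ℝ (StrongDual ℝ E)) :
    formExt (k + 1) C φ = formExt k (evalFirst (E := E) k C (φ 0)) (Fin.tail φ) := rfl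

/-- The Aron-Berner extension `E** × ⋯ × E** → F**` of `A` with respect to the permutation `ρ`.
Its value at `(φ₁, …, φₘ)` and `y*` is obtained from the form `y* ∘ A` by applying successively
`φ (ρ 1), …, φ (ρ m)` in the variables of index `ρ 1, …, ρ m`. -/
noncomputable def aronBerner {m : ℕ} (ρ : Equiv.Perm (Fin m))
    (A : ContinuousMultilinearMap ℝ (fun _ : Fin m => E) F) :
    ContinuousMultilinearMap ℝ (fun _ : Fin m => StrongDual ℝ (StrongDual ℝ E))
      (StrongDual ℝ (StrongDual ℝ F)) :=
  (ContinuousLinearMap.flipMultilinear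
    ((formExt m).comp
      (((ContinuousMultilinearMap.domDomCongrₗᵢ ℝ E ℝ
          ρ.symm).toContinuousLinearEquiv.toContinuousLinearMap).comp
        ((ContinuousLinearMap.compContinuousMultilinearMapL ℝ (fun _ : Fin m => E) F ℝ).flip
          A)))).domDomCongr ρ

/-- In `((y.compContinuousMultilinearMap A).domDomCongr ρ.symm)` the `k`-th variable is the
variable of index `ρ k` of `y ∘ A`. -/
theorem aronBerner_apply {m : ℕ} (ρ : Equiv.Perm (Fin m))
    (A : ContinuousMultilinearMap ℝ (fun _ : Fin m => E) F)
    (φ : Fin m → StrongDual ℝ (StrongDual ℝ E)) (y : StrongDual ℝ F) :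
    aronBerner ρ A φ y =
      formExt m ((y.compContinuousMultilinearMap A).domDomCongr ρ.symm) (fun k => φ (ρ k)) := rfl

end AronBerner

end BanachLattice

open BanachLattice

/-! ### Monotone sequences and disjoint sequences of functionals -/

namespace BanachLattice

/-! Freeze all variables but the j-th and let `ψ n` be a disjoint, weakly null, hence bounded,
sequence in E**. Arens regularity lets bidual elements be applied in any order, so the extension of
a scalar form is weak* continuous in each variable (`ArensRegular.exists_formExt_update`). With
every frozen φᵢ replaced by |φᵢ|, the extension of y ∘ A at ψ is therefore ψ (G y) for a positive
additive map G : F* → E*. Domination (`abs_formExt_le`) bounds the original values by |ψ n| (G |y|),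
and this has to tend to 0 uniformly for ‖y‖ ≤ 1.

For a fixed g, |ψ n| (G g) → 0: bounded disjoint sequences of functionals on a space where order
bounded monotone sequences are norm Cauchy have weak* null moduli. The positive Schur property gives
E* this monotone property.

Uniformity comes from a single g with ‖G (v - g)⁺‖ small for all positive v in the unit ball of F*.
If there were none, a recursion would give positive v n in the ball whose truncations w n = (v n -
2ⁿ ∑_{i<n} v i)⁺ have ‖G (w n)‖ bounded below. Order continuity of the norm of F makes w n weak*
null. Since operators E → F are weakly compact, the extension of A takes values in F, so χ (G (w n))
= w n (f) with f in F for each χ in E**. Thus G (w n) is positive and weakly null, and the positive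
Schur property makes it norm null, a contradiction.

For c₀ and ℓ₁, a gliding hump shows that operators c₀ → ℓ₁ are norm limits of finite rank operators.
The same argument applies to c₀ → c₀*, as c₀* embeds isometrically in ℓ₁. -/

/-- Monotone sequences that are bounded above are Cauchy. -/
def MonotoneCauchy (F : Type*) [NormedAddCommGroup F] [Lattice F] : Prop :=
  ∀ a : ℕ → F, Monotone a → BddAbove (Set.range a) → CauchySeq a

section Lattice

variable {F : Type*} [NormedAddCommGroup F] [NormedSpace ℝ F] [Lattice F] [HasSolidNorm F]
  [IsOrderedAddMonoid F]

theorem eq_zero_of_nsmul_le {v w : F} (hv : 0 ≤ v) (h : ∀ n : ℕ, n • v ≤ w) : v = 0 := by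
  by_contra hne
  have hpos : 0 < ‖v‖ := norm_pos_iff.2 hne
  obtain ⟨n, hn⟩ := exists_nat_gt (‖w‖ / ‖v‖)
  have h1 : ‖n • v‖ ≤ ‖w‖ := norm_le_of_nonneg_of_le (nsmul_nonneg hv n) (h n)
  rw [← Nat.cast_smul_eq_nsmul ℝ, norm_smul, Real.norm_natCast] at h1
  rw [div_lt_iff₀ hpos] at hn
  linarith

theorem cauchySeq_of_sub_norm_le {a : ℕ → F} (ha : Monotone a)
    (h : ∀ ε > 0, ∃ N, ∀ m ≥ N, ‖a m - a N‖ < ε) : CauchySeq a :=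
  Metric.cauchySeq_iff'.2 fun ε hε => by
    obtain ⟨N, hN⟩ := h ε hε
    exact ⟨N, fun m hm => by rw [dist_eq_norm]; exact hN m hm⟩

/-- The differences b - a n, with b ranging over all upper bounds, are directed downwards, and their
infimum is 0 without any order completeness. Indeed, if w is a lower bound, subtracting w⁺ from an
upper bound leaves an upper bound, and iterating this contradicts the Archimedean property unless w⁺
= 0. A difference b - a n of small norm then dominates every a m - a n with m ≥ n. -/
theorem OrderContinuousNorm.monotoneCauchy (hF : OrderContinuousNorm F) : MonotoneCauchy F := by
  rintro a ha ⟨b₀, hb₀⟩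
  let S : Set F := {s | ∃ b ∈ upperBounds (Set.range a), ∃ n, s = b - a n}
  have hb₀S : b₀ - a 0 ∈ S := ⟨b₀, hb₀, 0, rfl⟩
  have hdir : DirectedOn (· ≥ ·) S := by
    rintro _ ⟨b, hb, n, rfl⟩ _ ⟨c, hc, k, rfl⟩
    refine ⟨b ⊓ c - a (max n k), ⟨b ⊓ c, ?_, _, rfl⟩, ?_, ?_⟩
    · rintro _ ⟨i, rfl⟩
      exact le_inf (hb ⟨i, rfl⟩) (hc ⟨i, rfl⟩)
    · exact sub_le_sub inf_le_left (ha (le_max_left _ _))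
    · exact sub_le_sub inf_le_right (ha (le_max_right _ _))
  have hglb : IsGLB S 0 := by
    refine ⟨?_, fun w hw => ?_⟩
    · rintro _ ⟨b, hb, n, rfl⟩
      exact sub_nonneg.2 (hb ⟨n, rfl⟩)
    · have hw' : ∀ b ∈ upperBounds (Set.range a), ∀ n, w⁺ ≤ b - a n := fun b hb n =>
        sup_le (hw ⟨b, hb, n, rfl⟩) (sub_nonneg.2 (hb ⟨n, rfl⟩))
      have key : ∀ n : ℕ, b₀ - n • w⁺ ∈ upperBounds (Set.range a) := by
        intro n
        induction n with
        | zero => simpa using hb₀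
        | succ n ih =>
          rintro _ ⟨i, rfl⟩
          have := hw' _ ih i
          rw [le_sub_comm, sub_sub, ← succ_nsmul] at this
          exact this
      have h0 : w⁺ = 0 := by
        refine eq_zero_of_nsmul_le (w := b₀ - a 0) (posPart_nonneg w) fun n => ?_
        rw [le_sub_comm]
        exact key n ⟨0, rfl⟩
      exact posPart_eq_zero.1 h0
  have hlim := hF S ⟨_, hb₀S⟩ hdir hglb
  have : Nonempty S := ⟨⟨_, hb₀S⟩⟩
  have : IsDirected S (· ≥ ·) := ⟨directedOn_iff_directed.1 hdir⟩
  refine cauchySeq_of_sub_norm_le ha fun ε hε => ?_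
  obtain ⟨⟨_, b, hb, n, rfl⟩, hs⟩ := (hlim.eventually (gt_mem_nhds hε)).exists
  refine ⟨n, fun m hm => lt_of_le_of_lt ?_ hs⟩
  exact norm_le_of_nonneg_of_le (sub_nonneg.2 (ha hm)) (sub_le_sub_right (hb ⟨m, rfl⟩) _)

theorem WeaklyNull.of_nonneg {x : ℕ → F}
    (h : ∀ φ : StrongDual ℝ F, 0 ≤ φ → Tendsto (fun n => φ (x n)) atTop (𝓝 0)) :
    WeaklyNull x := fun φ => by
  have := (h φ⁺ (posPart_nonneg φ)).sub (h φ⁻ (negPart_nonneg φ))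
  rw [sub_zero] at this
  refine this.congr fun n => ?_
  rw [← sub_apply, posPart_sub_negPart]

/-- If the sequence were not Cauchy, some subsequence would have increments of norm at least ε. A
positive functional has telescoping, hence bounded, sums over these increments, so they are weakly
null, against the positive Schur property. -/
theorem PositiveSchur.monotoneCauchy (hF : PositiveSchur F) : MonotoneCauchy F := by
  rintro a ha ⟨b, hb⟩
  refine cauchySeq_of_sub_norm_le ha ?_
  by_contra! hcon
  obtain ⟨ε, hε, hN⟩ := hcon
  choose g hg1 hg2 using hN
  let k : ℕ → ℕ := fun n => g^[n] 0
  have hk : ∀ n, k (n + 1) = g (k n) := fun n => Function.iterate_succ_apply' g n 0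
  have hd : ∀ n, 0 ≤ a (k (n + 1)) - a (k n) := fun n => by
    rw [hk]; exact sub_nonneg.2 (ha (hg1 _))
  have hnull : WeaklyNull fun n => a (k (n + 1)) - a (k n) := by
    refine WeaklyNull.of_nonneg fun φ hφ => ?_
    refine Summable.tendsto_atTop_zero (summable_of_sum_range_le (c := φ (b - a (k 0)))
      (fun n => hφ _ (hd n)) fun n => ?_)
    rw [← map_sum, Finset.sum_range_sub fun n => a (k n)]
    have := hφ (b - a (k n)) (sub_nonneg.2 (hb ⟨_, rfl⟩))
    simp only [map_sub, zero_apply] at this ⊢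
    linarith
  obtain ⟨n, hn⟩ := ((hF _ hd hnull).eventually (gt_mem_nhds hε)).exists
  rw [hk] at hn
  exact absurd hn (not_lt.2 (hg2 _))

theorem MonotoneCauchy.exists_tendsto [CompleteSpace F] (hF : MonotoneCauchy F) {a : ℕ → F}
    (ha : Monotone a) {b : F} (hb : ∀ n, a n ≤ b) : ∃ l, Tendsto a atTop (𝓝 l) :=
  cauchySeq_tendsto_of_complete (hF a ha ⟨b, by rintro _ ⟨n, rfl⟩; exact hb n⟩)

/-- The suprema t n of the tails of z exist as norm limits of finite suprema and decrease in norm to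
some l. The geometric bound survives summation over the tail, so each y i is at most 0 at l; hence y
n (z n) ≤ y n (t n - l) ≤ M ‖t n - l‖. -/
theorem MonotoneCauchy.tendsto_apply_zero [CompleteSpace F] (hF : MonotoneCauchy F)
    {y : ℕ → StrongDual ℝ F} (hy : ∀ n, 0 ≤ y n) {M : ℝ} (hM : ∀ n, ‖y n‖ ≤ M) {x : F}
    {z : ℕ → F} (hz : ∀ n, 0 ≤ z n) (hzx : ∀ n, z n ≤ x) {c : ℝ}
    (hyz : ∀ n, ∀ i < n, y i (z n) ≤ c * (1 / 2) ^ n) :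
    Tendsto (fun n => y n (z n)) atTop (𝓝 0) := by
  let s : ℕ → ℕ → F := fun n m => partialSups (fun k => z (n + k)) m
  have hmono : ∀ n, Monotone (s n) := fun n => (partialSups _).mono
  have hsx : ∀ n m, s n m ≤ x := fun n m => partialSups_le _ _ _ fun _ _ => hzx _
  choose t ht using fun n => hF.exists_tendsto (hmono n) (hsx n)
  have hst : ∀ n m, s n m ≤ t n := fun n m => (hmono n).ge_of_tendsto (ht n) m
  have hzt : ∀ n, z n ≤ t n := fun n => by simpa [s] using hst n 0
  have hanti : Antitone t := by
    refine antitone_nat_of_succ_le fun n => le_of_tendsto' (ht (n + 1)) fun m => ?_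
    refine le_trans (partialSups_le _ _ _ fun k hk => ?_) (hst n (m + 1))
    have := le_partialSups_of_le (fun k => z (n + k)) (Nat.succ_le_succ hk)
    simpa [s, Nat.add_assoc, Nat.add_comm 1] using this
  obtain ⟨l, hl⟩ : ∃ l, Tendsto t atTop (𝓝 l) := by
    obtain ⟨l, hl⟩ := hF.exists_tendsto (a := fun n => -t n) (fun i j h => neg_le_neg (hanti h))
      (b := 0) fun n => neg_nonpos.2 ((hz n).trans (hzt n))
    exact ⟨-l, by simpa using hl.neg⟩
  have hlt : ∀ n, l ≤ t n := fun n => hanti.le_of_tendsto hl n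
  have hsum : ∀ n m, s n m ≤ ∑ k ∈ Finset.range (m + 1), z (n + k) := fun n m =>
    partialSups_le _ _ _ fun k hk =>
      Finset.single_le_sum (f := fun k => z (n + k)) (fun i _ => hz _)
        (Finset.mem_range.2 (Nat.lt_succ_of_le hk))
  have hmon : ∀ i {u w : F}, u ≤ w → y i u ≤ y i w := fun i u w h => by
    have := hy i (w - u) (sub_nonneg.2 h)
    rw [map_sub] at this
    simpa using this
  have hc : ∀ i, 0 ≤ c := fun i => by
    have h1 := hyz (i + 1) i (Nat.lt_succ_self i)
    have h2 : 0 ≤ y i (z (i + 1)) := hy i _ (hz _)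
    have h3 : (0 : ℝ) < (1 / 2) ^ (i + 1) := by positivity
    exact nonneg_of_mul_nonneg_left (h2.trans h1) h3
  have hyt : ∀ n, ∀ i < n, y i (t n) ≤ 2 * c * (1 / 2) ^ n := fun n i hi => by
    refine le_of_tendsto' (((y i).continuous.tendsto _).comp (ht n)) fun m => ?_
    refine (hmon i (hsum n m)).trans ?_
    rw [map_sum]
    calc ∑ k ∈ Finset.range (m + 1), y i (z (n + k))
        ≤ ∑ k ∈ Finset.range (m + 1), c * (1 / 2) ^ n * (1 / 2) ^ k := by
          refine Finset.sum_le_sum fun k _ => ?_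
          rw [mul_assoc, ← pow_add]
          exact hyz _ _ (by omega)
      _ = c * (1 / 2) ^ n * ∑ k ∈ Finset.range (m + 1), (1 / 2) ^ k := by rw [Finset.mul_sum]
      _ ≤ c * (1 / 2) ^ n * 2 := by
          refine mul_le_mul_of_nonneg_left (sum_geometric_two_le _)
            (mul_nonneg (hc 0) (by positivity))
      _ = 2 * c * (1 / 2) ^ n := by ring
  have hyl : ∀ i, y i l ≤ 0 := fun i => by
    have h0 : Tendsto (fun n : ℕ => 2 * c * (1 / 2 : ℝ) ^ n) atTop (𝓝 0) := by
      simpa using (tendsto_pow_atTop_nhds_zero_of_lt_one (r := (1 / 2 : ℝ)) (by norm_num)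
        (by norm_num)).const_mul (2 * c)
    refine ge_of_tendsto h0 ?_
    filter_upwards [eventually_gt_atTop i] with n hn
    exact (hmon i (hlt n)).trans (hyt n i hn)
  have hlim : Tendsto (fun n => M * ‖t n - l‖) atTop (𝓝 0) := by
    simpa using (tendsto_iff_norm_sub_tendsto_zero.1 hl).const_mul M
  refine squeeze_zero (fun n => hy n _ (hz n)) (fun n => ?_) hlim
  calc y n (z n) ≤ y n (t n) := hmon n (hzt n)
    _ ≤ y n (t n - l) := by rw [map_sub]; linarith [hyl n]
    _ ≤ ‖y n‖ * ‖t n - l‖ := (le_abs_self _).trans ((y n).le_opNorm _)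
    _ ≤ M * ‖t n - l‖ := mul_le_mul_of_nonneg_right (hM n) (norm_nonneg _)

theorem dual_posPart_eq (f : StrongDual ℝ F) : f⁺ = dualPos f := by
  change 0 + dualPos (f - 0) = dualPos f
  rw [zero_add, sub_zero]

/-- Truncating a bounded positive sequence of functionals by large multiples of the sum of the
preceding terms makes it weak* null. -/
theorem MonotoneCauchy.tendsto_posPart_sub_apply [CompleteSpace F] (hF : MonotoneCauchy F)
    {v : ℕ → StrongDual ℝ F} (hv : ∀ n, 0 ≤ v n) {M : ℝ} (hM : ∀ n, ‖v n‖ ≤ M) (x : F) :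
    Tendsto (fun n => (v n - (2 ^ n : ℕ) • ∑ i ∈ Finset.range n, v i)⁺ x) atTop (𝓝 0) := by
  set u : ℕ → StrongDual ℝ F := fun n => ∑ i ∈ Finset.range n, v i with hu
  have hu0 : ∀ n, 0 ≤ u n := fun n => Finset.sum_nonneg fun i _ => hv i
  set y : ℕ → StrongDual ℝ F := fun n => (v n - (2 ^ n : ℕ) • u n)⁺ with hydef
  have hy : ∀ n, 0 ≤ y n := fun n => posPart_nonneg _
  have hyv : ∀ n, y n ≤ v n := fun n =>
    sup_le (sub_le_self _ (nsmul_nonneg (hu0 n) _)) (hv n)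
  have hyM : ∀ n, ‖y n‖ ≤ M := fun n => (norm_le_of_nonneg_of_le (hy n) (hyv n)).trans (hM n)
  suffices H : ∀ x : F, 0 ≤ x → Tendsto (fun n => y n x) atTop (𝓝 0) by
    have := (H x⁺ (posPart_nonneg x)).sub (H x⁻ (negPart_nonneg x))
    rw [sub_zero] at this
    refine this.congr fun n => ?_
    rw [← map_sub, posPart_sub_negPart]
  intro x hx
  -- By the Riesz-Kantorovich formula the positive part at x is almost attained at some z in [0, x].
  have hex : ∀ n, ∃ z : F, 0 ≤ z ∧ z ≤ x ∧
      y n x - (1 / 2) ^ n < (v n - (2 ^ n : ℕ) • u n) z := by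
    intro n
    have h1 : y n x = sSup ((v n - (2 ^ n : ℕ) • u n) '' Set.Icc 0 x) := by
      rw [← dualPos_apply _ hx, ← dual_posPart_eq]
    have h2 : y n x - (1 / 2) ^ n < sSup ((v n - (2 ^ n : ℕ) • u n) '' Set.Icc 0 x) := by
      rw [← h1]
      exact sub_lt_self _ (by positivity)
    obtain ⟨_, ⟨z, hz, rfl⟩, hlt⟩ := exists_lt_of_lt_csSup
      ((Set.nonempty_Icc.2 hx).image _) h2
    exact ⟨z, hz.1, hz.2, hlt⟩
  choose z hz0 hzx hz using hex
  have hyz : ∀ n, y n x - (1 / 2) ^ n ≤ y n (z n) := fun n =>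
    (hz n).le.trans (le_posPart (v n - (2 ^ n : ℕ) • u n) _ (hz0 n))
  -- The almost maximal value at z n is at least -1, while v n (z n) ≤ M ‖x‖; so 2ⁿ u n (z n) ≤ M
  -- ‖x‖ + 1, and u n dominates every y i with i < n.
  have hsmall : ∀ n, ∀ i < n, y i (z n) ≤ (M * ‖x‖ + 1) * (1 / 2) ^ n := fun n i hi => by
    have h1 : y i (z n) ≤ u n (z n) := (hyv i (z n) (hz0 n)).trans
      (Finset.single_le_sum (f := v) (fun i _ => hv i) (Finset.mem_range.2 hi) (z n) (hz0 n))
    have h2 : v n (z n) ≤ M * ‖x‖ :=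
      (apply_le_of_mem_Icc (v n) ⟨hz0 n, hzx n⟩).trans
        (mul_le_mul_of_nonneg_right (hM n) (norm_nonneg x))
    have h3 := hz n
    have h4 : 0 ≤ y n x := hy n x hx
    have h5 : ((1 : ℝ) / 2) ^ n ≤ 1 := pow_le_one₀ (by norm_num) (by norm_num)
    have h6 : (v n - (2 ^ n : ℕ) • u n) (z n) = v n (z n) - 2 ^ n * u n (z n) := by
      rw [sub_apply, ← Nat.cast_smul_eq_nsmul ℝ, smul_apply, smul_eq_mul]
      push_cast
      ring
    rw [h6] at h3
    have h7 : 2 ^ n * u n (z n) ≤ M * ‖x‖ + 1 := by linarith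
    rw [one_div, inv_pow, ← div_eq_mul_inv, le_div_iff₀ (by positivity)]
    calc y i (z n) * 2 ^ n ≤ u n (z n) * 2 ^ n := by gcongr
      _ ≤ _ := by linarith
  have hlim := hF.tendsto_apply_zero hy hyM hz0 hzx hsmall
  have hp := tendsto_pow_atTop_nhds_zero_of_lt_one (r := (1 / 2 : ℝ)) (by norm_num) (by norm_num)
  have := hlim.add hp
  rw [add_zero] at this
  exact squeeze_zero (fun n => hy n x hx) (fun n => by linarith [hyz n]) this

end Lattice

/-! ### Truncation by disjoint elements -/

section Disjoint

variable {G : Type*} [AddCommGroup G] [Lattice G] [IsOrderedAddMonoid G]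

theorem posPart_sub_add {a b c : G} (hc : 0 ≤ c) : (a - (b + c))⁺ = ((a - b)⁺ - c)⁺ := by
  rw [posPart_def, posPart_def, posPart_def, sup_sub, sup_assoc, sub_sub, zero_sub,
    sup_of_le_right (neg_nonpos.2 hc)]

theorem posPart_sub_eq_of_inf_eq_zero {a b : G} (h : a ⊓ b = 0) : (a - b)⁺ = a := by
  rw [posPart_def, ← sub_self a, ← sub_inf, inf_comm, h, sub_zero]

/-- As (a - b)⁺ = a - a ⊓ b, the condition (a - b)⁺ = a says that a ⊓ b = 0. In this form it passes
to sums by truncating twice, with no infimum of a sum to compute. -/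
theorem posPart_sub_add_eq {a b c : G} (hc : 0 ≤ c) (hb : (a - b)⁺ = a) (h : (a - c)⁺ = a) :
    (a - (b + c))⁺ = a := by
  rw [posPart_sub_add hc, hb, h]

theorem posPart_sub_sum_eq {ι : Type*} {a : G} (ha : 0 ≤ a) {b : ι → G} (s : Finset ι)
    (hb : ∀ i ∈ s, 0 ≤ b i) (h : ∀ i ∈ s, a ⊓ b i = 0) : (a - ∑ i ∈ s, b i)⁺ = a := by
  classical
  induction s using Finset.induction_on with
  | empty => simpa using ha
  | insert i s hi ih =>
    rw [Finset.sum_insert hi, add_comm]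
    exact posPart_sub_add_eq (hb i (Finset.mem_insert_self i s))
      (ih (fun j hj => hb j (Finset.mem_insert_of_mem hj))
        fun j hj => h j (Finset.mem_insert_of_mem hj))
      (posPart_sub_eq_of_inf_eq_zero (h i (Finset.mem_insert_self i s)))

theorem posPart_sub_nsmul_eq {a b : G} (ha : 0 ≤ a) (hb : 0 ≤ b) (h : (a - b)⁺ = a) (n : ℕ) :
    (a - n • b)⁺ = a := by
  induction n with
  | zero => simpa using ha
  | succ n ih => rw [succ_nsmul]; exact posPart_sub_add_eq hb ih h

end Disjoint

/-- Bounded disjoint sequences of functionals have weak* null moduli. -/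
theorem MonotoneCauchy.tendsto_abs_apply_of_disjointSeq {F : Type*} [NormedAddCommGroup F]
    [NormedSpace ℝ F] [Lattice F] [HasSolidNorm F] [IsOrderedAddMonoid F] [CompleteSpace F]
    (hF : MonotoneCauchy F) {ψ : ℕ → StrongDual ℝ F} (hψ : DisjointSeq ψ) {M : ℝ}
    (hM : ∀ n, ‖ψ n‖ ≤ M) (x : F) : Tendsto (fun n => |ψ n| x) atTop (𝓝 0) := by
  have h := hF.tendsto_posPart_sub_apply (v := fun n => |ψ n|) (fun n => abs_nonneg _)
    (fun n => (norm_abs_eq_norm (ψ n)).trans_le (hM n)) x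
  refine h.congr fun n => ?_
  congr 1
  refine posPart_sub_nsmul_eq (abs_nonneg _) (Finset.sum_nonneg fun i _ => abs_nonneg _) ?_ _
  refine posPart_sub_sum_eq (abs_nonneg _) _ (fun i _ => abs_nonneg _) fun i hi => ?_
  exact hψ (Finset.mem_range.1 hi).ne'

theorem WeaklyNull.exists_norm_le {G : Type*} [NormedAddCommGroup G] [NormedSpace ℝ G]
    {x : ℕ → G} (hx : WeaklyNull x) : ∃ M, ∀ n, ‖x n‖ ≤ M := by
  obtain ⟨M, hM⟩ := banach_steinhaus
    (g := fun n => NormedSpace.inclusionInDoubleDual ℝ G (x n)) fun φ => by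
      obtain ⟨C, hC⟩ := (hx φ).norm.bddAbove_range
      exact ⟨C, fun n => hC ⟨n, rfl⟩⟩
  exact ⟨M, fun n => ((NormedSpace.inclusionInDoubleDualLi ℝ (E := G)).norm_map (x n)).symm.le.trans
    (hM n)⟩

end BanachLattice

/-! ### Weakly compact operators and the bidual -/

namespace BanachLattice

section WeaklyCompact

variable {G H : Type*} [NormedAddCommGroup G] [NormedSpace ℝ G]
  [NormedAddCommGroup H] [NormedSpace ℝ H]

/-- Helly's lemma: on finitely many functionals an element of the unit ball of the bidual is
approximated by an element of the unit ball. -/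
theorem exists_norm_le_one_abs_sub_le {φ : StrongDual ℝ (StrongDual ℝ G)} (hφ : ‖φ‖ ≤ 1)
    {ι : Type*} [Fintype ι] (g : ι → StrongDual ℝ G) {ε : ℝ} (hε : 0 < ε) :
    ∃ x : G, ‖x‖ ≤ 1 ∧ ∀ i, |g i x - φ (g i)| ≤ ε := by
  classical
  let L : G →ₗ[ℝ] (ι → ℝ) := LinearMap.pi fun i => (g i).toLinearMap
  let p : ι → ℝ := fun i => φ (g i)
  have hp : p ∈ closure (L '' Metric.closedBall 0 1) := by
    -- A functional f separating p from the image of the ball yields the combination h = ∑ f(eᵢ) gᵢ,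
    -- which has ‖h‖ ≤ u although φ h > u. This is impossible when ‖φ‖ ≤ 1.
    by_contra hp
    obtain ⟨f, u, hf, hu⟩ := geometric_hahn_banach_closed_point
      (((convex_closedBall (0 : G) 1).linear_image L).closure) isClosed_closure hp
    have hfa : ∀ a : ι → ℝ, f a = ∑ i, a i * f (Pi.single i 1) := fun a => by
      conv_lhs => rw [pi_eq_sum_univ' a, map_sum]
      refine Finset.sum_congr rfl fun i _ => ?_
      rw [map_smul, smul_eq_mul]
    let h : StrongDual ℝ G := ∑ i, f (Pi.single i 1) • g i
    have hh : ∀ x, h x = f (L x) := fun x => by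
      rw [hfa]
      simp only [h, sum_apply, smul_apply, smul_eq_mul]
      exact Finset.sum_congr rfl fun i _ => mul_comm _ _
    have hhp : φ h = f p := by
      rw [hfa]
      simp only [h, map_sum, map_smul, smul_eq_mul]
      exact Finset.sum_congr rfl fun i _ => mul_comm _ _
    have hlt : ∀ x : G, ‖x‖ ≤ 1 → h x < u := fun x hx => by
      rw [hh]
      exact hf _ (subset_closure ⟨x, mem_closedBall_zero_iff.2 hx, rfl⟩)
    have hu0 : 0 ≤ u := by simpa using (hlt 0 (by simp)).le
    have hnorm : ‖h‖ ≤ u := by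
      refine ContinuousLinearMap.opNorm_le_of_unit_norm hu0 fun x hx => ?_
      refine abs_le'.2 ⟨(hlt x hx.le).le, ?_⟩
      rw [← map_neg]
      exact (hlt (-x) (by rw [norm_neg, hx])).le
    have : φ h ≤ u := calc
      φ h ≤ ‖φ‖ * ‖h‖ := (le_abs_self _).trans (φ.le_opNorm h)
      _ ≤ 1 * u := mul_le_mul hφ hnorm (norm_nonneg _) zero_le_one
      _ = u := one_mul u
    rw [hhp] at this
    exact absurd hu (not_lt.2 this)
  obtain ⟨_, ⟨x, hx, rfl⟩, hd⟩ := Metric.mem_closure_iff.1 hp ε hε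
  refine ⟨x, mem_closedBall_zero_iff.1 hx, fun i => ?_⟩
  have := (dist_le_pi_dist p (L x) i).trans hd.le
  rwa [dist_comm, Real.dist_eq] at this

/-- The conditions |y(k) - φ(y ∘ T)| ≤ 1/(n+1) define weakly closed sets. By Helly's lemma any
finitely many of them meet the image of the ball, so by compactness all of them share a point of its
weak closure. -/
theorem IsWeaklyCompactOp.exists_eq_apply_of_norm_le {T : G →L[ℝ] H} (hT : IsWeaklyCompactOp T)
    {φ : StrongDual ℝ (StrongDual ℝ G)} (hφ : ‖φ‖ ≤ 1) :
    ∃ f : H, ∀ y : StrongDual ℝ H, φ (y.comp T) = y f := by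
  let t : StrongDual ℝ H × ℕ → Set (WeakSpace ℝ H) := fun i =>
    {k | |i.1 ((toWeakSpace ℝ H).symm k) - φ (i.1.comp T)| ≤ 1 / ((i.2 : ℝ) + 1)}
  have hcont : ∀ y : StrongDual ℝ H, Continuous fun k : WeakSpace ℝ H =>
      y ((toWeakSpace ℝ H).symm k) := fun y => WeakBilin.eval_continuous _ y
  have ht : ∀ i, IsClosed (t i) := fun i =>
    isClosed_le ((hcont i.1).sub continuous_const).abs continuous_const
  obtain ⟨k, -, hk⟩ := IsCompact.inter_iInter_nonempty hT t ht fun s => by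
    -- The largest n in the finite set gives the strictest tolerance, which serves all its members.
    have hpos : (0 : ℝ) < 1 / (((s.sup Prod.snd : ℕ) : ℝ) + 1) := by positivity
    obtain ⟨x, hx, hx'⟩ := exists_norm_le_one_abs_sub_le hφ
      (fun i : s => i.1.1.comp T) hpos
    refine ⟨toWeakSpace ℝ H (T x), subset_closure ⟨x, mem_closedBall_zero_iff.2 hx, rfl⟩, ?_⟩
    refine Set.mem_iInter₂.2 fun i hi => (hx' ⟨i, hi⟩).trans ?_
    have : i.2 ≤ s.sup Prod.snd := Finset.le_sup (f := Prod.snd) hi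
    exact one_div_le_one_div_of_le (by positivity) (by exact_mod_cast Nat.succ_le_succ this)
  refine ⟨(toWeakSpace ℝ H).symm k, fun y => ?_⟩
  have h1 : ∀ n : ℕ, |y ((toWeakSpace ℝ H).symm k) - φ (y.comp T)| ≤ 1 / ((n : ℝ) + 1) :=
    fun n => Set.mem_iInter.1 hk (y, n)
  have h2 := ge_of_tendsto' tendsto_one_div_add_atTop_nhds_zero_nat h1
  have h3 := abs_eq_zero.1 (le_antisymm h2 (abs_nonneg _))
  linarith

/-- The second adjoint of a weakly compact operator takes its values in the range. -/
theorem IsWeaklyCompactOp.exists_eq_apply {T : G →L[ℝ] H} (hT : IsWeaklyCompactOp T)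
    (φ : StrongDual ℝ (StrongDual ℝ G)) : ∃ f : H, ∀ y : StrongDual ℝ H, φ (y.comp T) = y f := by
  have hpos : 0 < ‖φ‖ + 1 := by positivity
  have hn : ‖(‖φ‖ + 1)⁻¹ • φ‖ ≤ 1 := by
    rw [norm_smul, norm_inv, Real.norm_of_nonneg hpos.le, inv_mul_le_iff₀ hpos]
    linarith
  obtain ⟨f, hf⟩ := hT.exists_eq_apply_of_norm_le hn
  refine ⟨(‖φ‖ + 1) • f, fun y => ?_⟩
  rw [map_smul, ← hf, smul_apply, smul_inv_smul₀ hpos.ne']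

/-- Functionals separate the points of H, so the value representing φ is unique and therefore linear
in T. Through Q, φ can be applied in one variable of an H-valued multilinear map with the result
still in H. -/
theorem exists_bidual_eval (h : ∀ T : G →L[ℝ] H, IsWeaklyCompactOp T)
    (φ : StrongDual ℝ (StrongDual ℝ G)) :
    ∃ Q : (G →L[ℝ] H) →L[ℝ] H, ∀ T (y : StrongDual ℝ H), y (Q T) = φ (y.comp T) := by
  choose Q hQ using fun T => (h T).exists_eq_apply φ
  refine ⟨LinearMap.mkContinuous
    { toFun := Q
      map_add' := fun S T => ?_
      map_smul' := fun c T => ?_ } ‖φ‖ fun T => ?_, fun T y => (hQ T y).symm⟩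
  · refine (SeparatingDual.eq_iff_forall_dual_eq (R := ℝ)).2 fun y => ?_
    rw [map_add, ← hQ, ← hQ, ← hQ, ContinuousLinearMap.comp_add, map_add]
  · refine (SeparatingDual.eq_iff_forall_dual_eq (R := ℝ)).2 fun y => ?_
    rw [map_smul, ← hQ, ← hQ, ContinuousLinearMap.comp_smul, map_smul, RingHom.id_apply]
  · refine NormedSpace.norm_le_dual_bound ℝ _ (by positivity) fun y => ?_
    change ‖y (Q T)‖ ≤ _
    rw [← hQ]
    calc ‖φ (y.comp T)‖ ≤ ‖φ‖ * ‖y.comp T‖ := φ.le_opNorm _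
      _ ≤ ‖φ‖ * (‖y‖ * ‖T‖) := by gcongr; exact y.opNorm_comp_le T
      _ = ‖φ‖ * ‖T‖ * ‖y‖ := by ring

/-- Weak compactness represents φ(· ∘ T) by some f in G*; testing against the points of G identifies
f with φ ∘ T.flip. The identity says that the two extensions of the bilinear form T to the bidual
coincide. -/
theorem ArensRegular.bidual_comm (hG : ArensRegular G) (T : G →L[ℝ] StrongDual ℝ G)
    (φ ψ : StrongDual ℝ (StrongDual ℝ G)) : φ (ψ.comp T) = ψ (φ.comp T.flip) := by
  obtain ⟨f, hf⟩ := (hG T).exists_eq_apply φ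
  rw [hf]
  congr 1
  ext x
  exact (hf (NormedSpace.inclusionInDoubleDual ℝ G x)).symm

end WeaklyCompact

/-! ### Extensions of multilinear forms -/

section Forms

variable {E F : Type*} [NormedAddCommGroup E] [NormedSpace ℝ E]
  [NormedAddCommGroup F] [NormedSpace ℝ F]

/-- Each application of a bidual element is carried out inside F by `exists_bidual_eval`, which
leaves an F-valued map with one variable fewer. -/
theorem exists_formExt_comp_eq_apply (h : ∀ T : E →L[ℝ] F, IsWeaklyCompactOp T) (m : ℕ)
    (B : ContinuousMultilinearMap ℝ (fun _ : Fin m => E) F)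
    (φ : Fin m → StrongDual ℝ (StrongDual ℝ E)) :
    ∃ f : F, ∀ y : StrongDual ℝ F, formExt m (y.compContinuousMultilinearMap B) φ = y f := by
  induction m with
  | zero => exact ⟨B 0, fun y => rfl⟩
  | succ k ih =>
    obtain ⟨Q, hQ⟩ := exists_bidual_eval h (φ 0)
    obtain ⟨f, hf⟩ := ih (Q.compContinuousMultilinearMap B.curryLeft.flipMultilinear)
      (Fin.tail φ)
    refine ⟨f, fun y => ?_⟩
    rw [formExt_succ, ← hf]
    congr 2
    ext x
    exact (hQ (B.curryLeft.flipMultilinear x) y).symm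

theorem swap_comp_cons_cons {α : Type*} {k : ℕ} (a b : α) (x : Fin k → α) :
    (fun i => (Fin.cons b (Fin.cons a x : Fin (k + 1) → α) : Fin (k + 2) → α)
      (Equiv.swap 0 1 i)) = (Fin.cons a (Fin.cons b x : Fin (k + 1) → α) : Fin (k + 2) → α) := by
  funext i
  refine Fin.cases ?_ (fun i => Fin.cases ?_ (fun i => ?_) i) i
  · rw [Equiv.swap_apply_left]; rfl
  · rw [Fin.succ_zero_eq_one, Equiv.swap_apply_right]; rfl
  · rw [Equiv.swap_apply_of_ne_of_ne (Fin.succ_ne_zero _)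
      (fun h => Fin.succ_ne_zero i (Fin.succ_injective _ (h.trans Fin.succ_zero_eq_one.symm)))]
    rfl

/-- In an Arens regular space the extension is weak* continuous in the variable treated first. -/
theorem ArensRegular.formExt_evalFirst (hE : ArensRegular E) (k : ℕ)
    (C : ContinuousMultilinearMap ℝ (fun _ : Fin (k + 1) => E) ℝ)
    (ψ : StrongDual ℝ (StrongDual ℝ E)) (θ : Fin k → StrongDual ℝ (StrongDual ℝ E))
    (g : StrongDual ℝ E) (hg : ∀ x, g x = formExt k (C.curryLeft x) θ) :
    formExt k (evalFirst (E := E) k C ψ) θ = ψ g := by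
  induction k with
  | zero =>
    have : g = firstSlice C 0 := by
      ext x
      rw [hg]
      rfl
    rw [this]
    rfl
  | succ k ih =>
    -- The variable of ψ is moved past the next one: D is C with θ 0 applied in the second variable,
    -- and `bidual_comm` shows that applying ψ to D equals applying ψ and then θ 0 to C. The
    -- induction hypothesis for D moves ψ past the remaining variables.
    let S : ContinuousMultilinearMap ℝ (fun _ : Fin (k + 2) => E) ℝ :=
      C.domDomCongr (Equiv.swap 0 1)
    have hS : ∀ (a b : E) (x : Fin k → E),
        S (Fin.cons b (Fin.cons a x : Fin (k + 1) → E)) =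
          C (Fin.cons a (Fin.cons b x : Fin (k + 1) → E)) := fun a b x =>
      congrArg C (swap_comp_cons_cons a b x)
    let D : ContinuousMultilinearMap ℝ (fun _ : Fin (k + 1) => E) ℝ :=
      evalFirst (E := E) (k + 1) S (θ 0)
    have h1 : evalFirst (E := E) k (evalFirst (E := E) (k + 1) C ψ) (θ 0) =
        evalFirst (E := E) k D ψ := by
      ext x
      let T : E →L[ℝ] StrongDual ℝ E :=
        (ContinuousMultilinearMap.apply ℝ (fun _ : Fin k => E) (StrongDual ℝ E) x).comp
          C.curryLeft.flipMultilinear.curryLeft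
      have hT : ∀ a b, T b a = C (Fin.cons a (Fin.cons b x : Fin (k + 1) → E)) :=
        fun a b => rfl
      have e1 : firstSlice (evalFirst (E := E) (k + 1) C ψ) x = ψ.comp T := by
        ext b
        rfl
      have e2 : firstSlice D x = (θ 0).comp T.flip := by
        ext a
        change θ 0 (firstSlice S (Fin.cons a x)) = θ 0 (T.flip a)
        congr 1
        ext b
        rw [firstSlice_apply, hS]
        rfl
      rw [evalFirst_apply, evalFirst_apply, e1, e2, hE.bidual_comm]
    rw [formExt_succ, h1]
    refine ih D (Fin.tail θ) fun x => ?_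
    rw [hg, formExt_succ]
    congr 2
    ext z
    change θ 0 (firstSlice (C.curryLeft x) z) = θ 0 (firstSlice S (Fin.cons x z))
    congr 1
    ext b
    rw [firstSlice_apply, firstSlice_apply, hS]
    rfl

/-- The variables before j are absorbed into the form one at a time, until j is the variable treated
first. -/
theorem ArensRegular.exists_formExt_update (hE : ArensRegular E) (m : ℕ)
    (C : ContinuousMultilinearMap ℝ (fun _ : Fin m => E) ℝ)
    (θ : Fin m → StrongDual ℝ (StrongDual ℝ E)) (j : Fin m) :
    ∃ g : StrongDual ℝ E, ∀ ψ, formExt m C (Function.update θ j ψ) = ψ g := by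
  induction m with
  | zero => exact j.elim0
  | succ k ih =>
    refine Fin.cases ?_ (fun i => ?_) j
    · refine ⟨(ContinuousMultilinearMap.apply ℝ _ ℝ (Fin.tail θ)).comp
        ((formExt k).comp C.curryLeft), fun ψ => ?_⟩
      rw [formExt_succ, Function.update_self, Fin.tail_update_zero]
      exact hE.formExt_evalFirst k C ψ _ _ fun x => rfl
    · obtain ⟨g, hg⟩ := ih (evalFirst (E := E) k C (θ 0)) (Fin.tail θ) i
      refine ⟨g, fun ψ => ?_⟩
      rw [formExt_succ, Fin.tail_update_succ, Function.update_of_ne (Fin.succ_ne_zero i).symm, hg]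

/-- Domination survives each evaluation: |φ(C(•, x))| ≤ |φ|(|C(•, x)|) ≤ |φ|(D(•, x)) for x ≥ 0. -/
theorem abs_formExt_le {E : Type*} [NormedAddCommGroup E] [NormedSpace ℝ E] [Lattice E]
    [HasSolidNorm E] [IsOrderedAddMonoid E] (m : ℕ)
    (C D : ContinuousMultilinearMap ℝ (fun _ : Fin m => E) ℝ)
    (h : ∀ x : Fin m → E, (∀ i, 0 ≤ x i) → |C x| ≤ D x)
    (φ : Fin m → StrongDual ℝ (StrongDual ℝ E)) :
    |formExt m C φ| ≤ formExt m D fun i => |φ i| := by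
  induction m with
  | zero => exact h 0 fun i => le_rfl
  | succ k ih =>
    rw [formExt_succ, formExt_succ]
    refine ih _ _ (fun x hx => ?_) _
    rw [evalFirst_apply, evalFirst_apply]
    refine (abs_apply_le (φ 0) _).trans ?_
    have hcons : ∀ e : E, 0 ≤ e → ∀ i, 0 ≤ (Fin.cons e x : Fin (k + 1) → E) i :=
      fun e he => Fin.cases he hx
    have hle : |firstSlice C x| ≤ firstSlice D x := by
      refine abs_le'.2 ⟨fun e he => ?_, fun e he => ?_⟩
      · exact (le_abs_self _).trans (h _ (hcons e he))
      · exact (neg_le_abs _).trans (h _ (hcons e he))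
    have := abs_nonneg (φ 0) _ (sub_nonneg.2 hle)
    rw [map_sub] at this
    simpa using this

end Forms

end BanachLattice

/-! ### Positive multilinear operators -/

namespace BanachLattice

section Positive

variable {E F : Type*} [NormedAddCommGroup E] [NormedSpace ℝ E] [Lattice E] [HasSolidNorm E]
  [IsOrderedAddMonoid E] [NormedAddCommGroup F] [NormedSpace ℝ F] [Lattice F] [HasSolidNorm F]
  [IsOrderedAddMonoid F]

theorem PositiveMultilinear.mono {m : ℕ} {A : MultilinearMap ℝ (fun _ : Fin m => E) F}
    (hA : PositiveMultilinear A) {x y : Fin m → E} (hx : ∀ i, 0 ≤ x i) (hxy : ∀ i, x i ≤ y i) :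
    A x ≤ A y := by
  have h : y = x + (y - x) := by abel
  rw [h, A.map_add_univ]
  have hnn : ∀ s : Finset (Fin m), 0 ≤ A (s.piecewise x (y - x)) := fun s => hA _ fun i => by
    by_cases hi : i ∈ s
    · rw [Finset.piecewise_eq_of_mem _ _ _ hi]; exact hx i
    · rw [Finset.piecewise_eq_of_notMem _ _ _ hi]; exact sub_nonneg.2 (hxy i)
  simpa using Finset.single_le_sum (f := fun s : Finset (Fin m) => A (s.piecewise x (y - x)))
    (fun s _ => hnn s) (Finset.mem_univ Finset.univ)

theorem norm_posPart_le (x : E) : ‖x⁺‖ ≤ ‖x‖ := by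
  refine norm_le_norm_of_abs_le_abs ?_
  rw [abs_of_nonneg (posPart_nonneg x), ← posPart_add_negPart x]
  exact le_add_of_nonneg_right (negPart_nonneg x)

theorem norm_negPart_le (x : E) : ‖x⁻‖ ≤ ‖x‖ := by
  simpa using norm_posPart_le (-x)

/-- Otherwise pick x n ≥ 0 in the ball with ‖A (x n)‖ > 2ⁿᵐ n. The sums zᵢ = ∑ 2⁻ⁿ x n i dominate
every term, so by monotonicity ‖A z‖ ≥ n for all n; scaling all m variables by 2⁻ⁿ is what the
factor 2ⁿᵐ offsets. -/
theorem PositiveMultilinear.exists_bound_of_nonneg [CompleteSpace E] [IsOrderedModule ℝ E] {m : ℕ}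
    {A : MultilinearMap ℝ (fun _ : Fin m => E) F} (hA : PositiveMultilinear A) :
    ∃ K : ℝ, ∀ x : Fin m → E, (∀ i, 0 ≤ x i) → (∀ i, ‖x i‖ ≤ 1) → ‖A x‖ ≤ K := by
  by_contra! hcon
  choose x hx0 hx1 hx using fun n : ℕ => hcon ((2 ^ n) ^ m * n)
  have hsum : ∀ i, Summable fun n : ℕ => (1 / 2 : ℝ) ^ n • x n i := fun i => by
    refine Summable.of_norm_bounded (g := fun n : ℕ => (1 / 2 : ℝ) ^ n)
      summable_geometric_two fun n => ?_
    rw [norm_smul, norm_pow, Real.norm_of_nonneg (by norm_num)]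
    exact mul_le_of_le_one_right (by positivity) (hx1 n i)
  have hterm : ∀ i n, 0 ≤ (1 / 2 : ℝ) ^ n • x n i := fun i n =>
    smul_nonneg (by positivity) (hx0 n i)
  let z : Fin m → E := fun i => ∑' n : ℕ, (1 / 2 : ℝ) ^ n • x n i
  have hz : ∀ n i, (1 / 2 : ℝ) ^ n • x n i ≤ z i := fun n i =>
    (hsum i).le_tsum n fun k _ => hterm i k
  obtain ⟨n, hn⟩ := exists_nat_gt ‖A z‖
  have h1 : A (fun i => (1 / 2 : ℝ) ^ n • x n i) ≤ A z :=
    hA.mono (fun i => hterm i n) (hz n)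
  have h2 := norm_le_of_nonneg_of_le (hA _ fun i => hterm i n) h1
  rw [A.map_smul_univ (fun _ => (1 / 2 : ℝ) ^ n) (x n), Finset.prod_const, Finset.card_univ,
    Fintype.card_fin, norm_smul, norm_pow, norm_pow, Real.norm_of_nonneg (by norm_num)] at h2
  have h3 := hx n
  have h4 : ((1 / 2 : ℝ) ^ n) ^ m * ((2 ^ n) ^ m * n) = n := by
    rw [← mul_assoc, ← mul_pow, ← mul_pow]
    norm_num
  have h5 : ((1 / 2 : ℝ) ^ n) ^ m * ((2 ^ n) ^ m * n) ≤ ((1 / 2 : ℝ) ^ n) ^ m * ‖A (x n)‖ := by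
    gcongr
  linarith

/-- Homogeneity carries the bound on the ball to all positive arguments; splitting each variable
into positive and negative parts gives 2ᵐ terms, each bounded in this way. -/
theorem PositiveMultilinear.continuous [CompleteSpace E] [IsOrderedModule ℝ E] {m : ℕ}
    {A : MultilinearMap ℝ (fun _ : Fin m => E) F} (hA : PositiveMultilinear A) :
    Continuous A := by
  obtain ⟨K, hK⟩ := hA.exists_bound_of_nonneg
  have hK0 : 0 ≤ K := (norm_nonneg _).trans (hK 0 (fun _ => le_rfl) fun _ => by simp)
  have hpos : ∀ x : Fin m → E, (∀ i, 0 ≤ x i) → ‖A x‖ ≤ K * ∏ i, ‖x i‖ := fun x hx => by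
    have h1 : x = fun i => ‖x i‖ • ‖x i‖⁻¹ • x i := by
      funext i
      rcases eq_or_ne (x i) 0 with h | h
      · rw [h]; simp
      · rw [smul_inv_smul₀ (norm_ne_zero_iff.2 h)]
    have h2 : A x = (∏ i, ‖x i‖) • A fun i => ‖x i‖⁻¹ • x i := by
      conv_lhs => rw [h1]
      exact A.map_smul_univ _ _
    rw [h2, norm_smul, Real.norm_of_nonneg (Finset.prod_nonneg fun i _ => norm_nonneg _), mul_comm]
    refine mul_le_mul_of_nonneg_right (hK _ (fun i => ?_) fun i => ?_)
      (Finset.prod_nonneg fun i _ => norm_nonneg _)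
    · exact smul_nonneg (inv_nonneg.2 (norm_nonneg _)) (hx i)
    · rw [norm_smul, norm_inv, norm_norm]
      exact inv_mul_le_one
  refine A.continuous_of_bound (2 ^ m * K) fun x => ?_
  have hx : x = (fun i => (x i)⁺) + fun i => -(x i)⁻ := by
    funext i
    rw [Pi.add_apply, ← sub_eq_add_neg, posPart_sub_negPart]
  have hterm : ∀ s : Finset (Fin m),
      ‖A (s.piecewise (fun i => (x i)⁺) fun i => -(x i)⁻)‖ ≤ K * ∏ i, ‖x i‖ := fun s => by
    have h1 : (s.piecewise (fun i => (x i)⁺) fun i => -(x i)⁻) =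
        fun i => (if i ∈ s then (1 : ℝ) else -1) • if i ∈ s then (x i)⁺ else (x i)⁻ := by
      funext i
      by_cases hi : i ∈ s <;> simp [hi]
    rw [h1, A.map_smul_univ, norm_smul, norm_prod]
    have h2 : ∏ i, ‖if i ∈ s then (1 : ℝ) else -1‖ = 1 :=
      Finset.prod_eq_one fun i _ => by split_ifs <;> simp
    rw [h2, one_mul]
    refine (hpos _ fun i => ?_).trans (mul_le_mul_of_nonneg_left
      (Finset.prod_le_prod (fun i _ => norm_nonneg _) fun i _ => ?_) hK0)
    · split_ifs
      exacts [posPart_nonneg _, negPart_nonneg _]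
    · split_ifs
      exacts [norm_posPart_le _, norm_negPart_le _]
  calc ‖A x‖ = ‖∑ s : Finset (Fin m), A (s.piecewise (fun i => (x i)⁺) fun i => -(x i)⁻)‖ := by
        rw [← A.map_add_univ, ← hx]
    _ ≤ ∑ _s : Finset (Fin m), K * ∏ i, ‖x i‖ :=
        norm_sum_le_of_le _ fun s _ => hterm s
    _ = 2 ^ m * K * ∏ i, ‖x i‖ := by
        rw [Finset.sum_const, Finset.card_univ, Fintype.card_finset, Fintype.card_fin,
          nsmul_eq_mul]
        push_cast
        ring

theorem formExt_nonneg {m : ℕ} {C : ContinuousMultilinearMap ℝ (fun _ : Fin m => E) ℝ}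
    (hC : ∀ x : Fin m → E, (∀ i, 0 ≤ x i) → 0 ≤ C x)
    {φ : Fin m → StrongDual ℝ (StrongDual ℝ E)} (hφ : ∀ i, 0 ≤ φ i) : 0 ≤ formExt m C φ := by
  have h := (abs_nonneg _).trans
    (abs_formExt_le m C C (fun x hx => (abs_of_nonneg (hC x hx)).le) φ)
  rwa [show (fun i => |φ i|) = φ from funext fun i => abs_of_nonneg (hφ i)] at h

/-- If `q` tends to zero along the sequences obtained from bounded positive sequences by truncating
each term by large multiples of the sum of the preceding ones, then `q` is small on `(v - g)⁺` for
some `g` and all positive `v` in the ball. -/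
theorem exists_forall_posPart_sub_le {X : Type*} [NormedAddCommGroup X] [Lattice X]
    (q : X → ℝ) {M : ℝ}
    (h : ∀ v : ℕ → X, (∀ n, 0 ≤ v n) → (∀ n, ‖v n‖ ≤ M) →
      Tendsto (fun n => q (v n - (2 ^ n : ℕ) • ∑ i ∈ Finset.range n, v i)⁺) atTop (𝓝 0))
    {ε : ℝ} (hε : 0 < ε) : ∃ g : X, ∀ v, 0 ≤ v → ‖v‖ ≤ M → q (v - g)⁺ ≤ ε := by
  by_contra! hcon
  choose c hc0 hcM hc using hcon
  -- If every g fails with a witness c g, the recursion makes s n the sum of the earlier witnesses c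
  -- (2ᵏ s k). The n-th witness is then chosen against exactly the truncation 2ⁿ s n occurring in
  -- `h`.
  let s : ℕ → X := fun n => Nat.rec 0 (fun k t => t + c ((2 ^ k : ℕ) • t)) n
  have hs : ∀ n, s n = ∑ i ∈ Finset.range n, c ((2 ^ i : ℕ) • s i) := fun n => by
    induction n with
    | zero => rfl
    | succ n ih => rw [Finset.sum_range_succ, ← ih]
  have hlim := h (fun n => c ((2 ^ n : ℕ) • s n)) (fun n => hc0 _) fun n => hcM _
  obtain ⟨n, hn⟩ := (hlim.eventually (gt_mem_nhds hε)).exists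
  rw [← hs] at hn
  exact absurd hn (not_lt.2 (hc _).le)

theorem eventually_abs_formExt_update_le [CompleteSpace E] [CompleteSpace F]
    (hE : ArensRegular E) (hE' : PositiveSchur (StrongDual ℝ E)) (hF : OrderContinuousNorm F)
    (hEF : ∀ T : E →L[ℝ] F, IsWeaklyCompactOp T) {m : ℕ}
    (B : ContinuousMultilinearMap ℝ (fun _ : Fin m => E) F)
    (hB : ∀ x : Fin m → E, (∀ i, 0 ≤ x i) → 0 ≤ B x)
    (φ : Fin m → StrongDual ℝ (StrongDual ℝ E)) (j : Fin m)
    {ψ : ℕ → StrongDual ℝ (StrongDual ℝ E)} (hψ : DisjointSeq ψ) {M : ℝ} (hM : ∀ n, ‖ψ n‖ ≤ M)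
    {ε : ℝ} (hε : 0 < ε) :
    ∀ᶠ n in atTop, ∀ y : StrongDual ℝ F, ‖y‖ ≤ 1 →
      |formExt m (y.compContinuousMultilinearMap B) (Function.update φ j (ψ n))| ≤ ε := by
  have hM0 : 0 ≤ M := (norm_nonneg _).trans (hM 0)
  let θ : Fin m → StrongDual ℝ (StrongDual ℝ E) := fun i => |φ i|
  have hθ : ∀ ψ', 0 ≤ ψ' → ∀ i, 0 ≤ Function.update θ j ψ' i := fun ψ' h i => by
    rcases eq_or_ne i j with rfl | hi
    · rwa [Function.update_self]
    · rw [Function.update_of_ne hi]; exact abs_nonneg _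
  -- G y in E* represents the dependence on the j-th variable; positivity and additivity of G are
  -- inherited from the extension.
  choose G hG using fun y : StrongDual ℝ F =>
    hE.exists_formExt_update m (y.compContinuousMultilinearMap B) θ j
  have hG0 : ∀ y, 0 ≤ y → 0 ≤ G y := fun y hy x hx => by
    have h1 : 0 ≤ NormedSpace.inclusionInDoubleDual ℝ E x := fun f hf => hf x hx
    have h2 := formExt_nonneg (C := y.compContinuousMultilinearMap B)
      (fun x hx => hy _ (hB x hx)) (hθ _ h1)
    rw [hG] at h2
    exact h2
  have hGadd : ∀ y w, G (y + w) = G y + G w := fun y w => by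
    ext x
    have h1 : (y + w).compContinuousMultilinearMap B =
        y.compContinuousMultilinearMap B + w.compContinuousMultilinearMap B := rfl
    have h2 := hG (y + w) (NormedSpace.inclusionInDoubleDual ℝ E x)
    rw [h1, map_add, add_apply, hG, hG] at h2
    exact h2.symm
  have hGmono : ∀ y w, y ≤ w → G y ≤ G w := fun y w h => by
    have := hGadd y (w - y)
    rw [add_sub_cancel] at this
    rw [this]
    exact le_add_of_nonneg_right (hG0 _ (sub_nonneg.2 h))
  -- Testing G on a truncation against χ evaluates the truncation at a point f of F, where weak*
  -- nullity applies; the positive Schur property turns the resulting weak convergence into norm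
  -- convergence. The denominator M + 1 allows for M = 0.
  obtain ⟨g, hg⟩ := exists_forall_posPart_sub_le (fun y : StrongDual ℝ F => ‖G y‖) (M := 1)
    (fun v hv hv1 => by
      refine hE' _ (fun n => hG0 _ (posPart_nonneg _)) fun χ => ?_
      obtain ⟨f, hf⟩ := exists_formExt_comp_eq_apply hEF m B (Function.update θ j χ)
      refine (hF.monotoneCauchy.tendsto_posPart_sub_apply hv hv1 f).congr fun n => ?_
      rw [← hf, hG])
    (show 0 < ε / 2 / (M + 1) by positivity)
  have hlim := (hE'.monotoneCauchy).tendsto_abs_apply_of_disjointSeq hψ hM (G g)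
  filter_upwards [hlim.eventually (gt_mem_nhds (half_pos hε))] with n hn y hy
  have h1 : |formExt m (y.compContinuousMultilinearMap B) (Function.update φ j (ψ n))| ≤
      |ψ n| (G |y|) := by
    refine (abs_formExt_le m _ (|y|.compContinuousMultilinearMap B) (fun x hx => ?_) _).trans ?_
    · refine (abs_apply_le y (B x)).trans ?_
      rw [abs_of_nonneg (hB x hx)]
      rfl
    · rw [← hG]
      refine le_of_eq (congrArg _ (funext fun i => ?_))
      rcases eq_or_ne i j with rfl | hi
      · rw [Function.update_self, Function.update_self]
      · rw [Function.update_of_ne hi, Function.update_of_ne hi]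
  have h2 : |y| ≤ g + (|y| - g)⁺ := by
    rw [← sub_le_iff_le_add']
    exact le_posPart _
  have h3 : |ψ n| (G |y|) ≤ |ψ n| (G g) + |ψ n| (G (|y| - g)⁺) := by
    have h := abs_nonneg (ψ n) _ (sub_nonneg.2 (hGmono _ _ h2))
    rw [hGadd, map_sub, map_add] at h
    simpa using h
  have h4 : |ψ n| (G (|y| - g)⁺) ≤ M * (ε / 2 / (M + 1)) := calc
    |ψ n| (G (|y| - g)⁺) ≤ ‖ψ n‖ * ‖G (|y| - g)⁺‖ :=
      dual_abs_le_norm (ψ n) (hG0 _ (posPart_nonneg _))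
    _ ≤ M * (ε / 2 / (M + 1)) :=
      mul_le_mul (hM n) (hg |y| (abs_nonneg _) ((norm_abs_eq_norm y).trans_le hy))
        (norm_nonneg _) hM0
  have h5 : M * (ε / 2 / (M + 1)) ≤ ε / 2 := by
    rw [mul_div_assoc', div_le_iff₀ (by positivity)]
    nlinarith
  linarith

/-- The estimate is uniform over the unit ball of F*, so it bounds the norm in F**. After reindexing
by ρ, the j-th variable is the one of index ρ⁻¹ j. -/
theorem PositiveMultilinear.separatelyAlmostDunfordPettis [CompleteSpace E] [CompleteSpace F]
    (hE : ArensRegular E) (hE' : PositiveSchur (StrongDual ℝ E)) (hF : OrderContinuousNorm F)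
    (hEF : ∀ T : E →L[ℝ] F, IsWeaklyCompactOp T) {m : ℕ}
    {A : ContinuousMultilinearMap ℝ (fun _ : Fin m => E) F}
    (hA : PositiveMultilinear A.toMultilinearMap) (ρ : Equiv.Perm (Fin m)) :
    SeparatelyAlmostDunfordPettis (aronBerner ρ A).toMultilinearMap := by
  intro j φ ψ hψ hψ0
  obtain ⟨M, hM⟩ := hψ0.exists_norm_le
  refine tendsto_order.2 ⟨fun a ha => Eventually.of_forall fun n => ha.trans_le (norm_nonneg _),
    fun ε hε => ?_⟩
  filter_upwards [eventually_abs_formExt_update_le hE hE' hF hEF (A.domDomCongr ρ.symm)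
    (fun x hx => hA _ fun i => hx _) (fun k => φ (ρ k)) (ρ.symm j) hψ hM (half_pos hε)] with n hn
  refine lt_of_le_of_lt (ContinuousLinearMap.opNorm_le_of_unit_norm (half_pos hε).le
    fun y hy => ?_) (half_lt_self hε)
  have h1 : (fun k => Function.update φ j (ψ n) (ρ k)) =
      Function.update (fun k => φ (ρ k)) (ρ.symm j) (ψ n) := by
    funext k
    rcases eq_or_ne k (ρ.symm j) with rfl | hk
    · rw [Function.update_self, Equiv.apply_symm_apply, Function.update_self]
    · rw [Function.update_of_ne hk, Function.update_of_ne]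
      exact fun h => hk (by rw [← h, Equiv.symm_apply_apply])
  have h2 := hn y hy.le
  rw [← h1] at h2
  exact h2

end Positive

end BanachLattice

/-! ### The Banach lattices `c₀` and `ℓ₁` -/

namespace BanachLattice

/-! ### Tails and order continuity of the norm in ℓ₁ -/

section LOne

theorem lOne_summable (s : lp (fun _ : ℕ => ℝ) 1) : Summable fun n => |s n| :=
  memlp_one_iff.1 s.2

theorem lOne_norm_eq (s : lp (fun _ : ℕ => ℝ) 1) : ‖s‖ = ∑' n, |s n| := by
  rw [lp.norm_eq_tsum_rpow (by simp)]
  simp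

theorem lOne_norm_eq_add (s : lp (fun _ : ℕ => ℝ) 1) (N : ℕ) :
    ‖s‖ = ∑ n ∈ Finset.range N, |s n| + ∑' n, |s (n + N)| := by
  rw [lOne_norm_eq, (lOne_summable s).sum_add_tsum_nat_add]

theorem lOne_summable_nat_add (s : lp (fun _ : ℕ => ℝ) 1) (N : ℕ) :
    Summable fun n => |s (n + N)| :=
  (summable_nat_add_iff N).2 (lOne_summable s)

theorem lOne_tendsto_tail (s : lp (fun _ : ℕ => ℝ) 1) :
    Tendsto (fun N => ∑' n, |s (n + N)|) atTop (𝓝 0) :=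
  _root_.tendsto_sum_nat_add fun n => |s n|

/-- Coordinatewise null sequences in `ℓ₁` are asymptotically disjoint from any given element. -/
theorem lOne_eventually_norm_add_ge (s : lp (fun _ : ℕ => ℝ) 1)
    {w : ℕ → lp (fun _ : ℕ => ℝ) 1} (hw : ∀ k, Tendsto (fun n => w n k) atTop (𝓝 0))
    {δ : ℝ} (hδ : 0 < δ) : ∀ᶠ n in atTop, ‖s‖ + ‖w n‖ - δ ≤ ‖s + w n‖ := by
  -- The loss is twice the tail of s beyond N plus twice the part of w n before N, hence four
  -- quarters of δ.
  have hδ4 : 0 < δ / 4 := by positivity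
  obtain ⟨N, hN⟩ := ((lOne_tendsto_tail s).eventually (gt_mem_nhds hδ4)).exists
  have hlim : Tendsto (fun n => ∑ k ∈ Finset.range N, |w n k|) atTop (𝓝 0) := by
    simpa using tendsto_finsetSum (Finset.range N) fun k _ => (hw k).abs
  filter_upwards [hlim.eventually (gt_mem_nhds hδ4)] with n hn
  rw [lOne_norm_eq_add s N, lOne_norm_eq_add (w n) N, lOne_norm_eq_add (s + w n) N]
  have h1 : ∑ k ∈ Finset.range N, |s k| - ∑ k ∈ Finset.range N, |w n k| ≤
      ∑ k ∈ Finset.range N, |(s + w n) k| := by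
    rw [← Finset.sum_sub_distrib]
    refine Finset.sum_le_sum fun k _ => ?_
    have := abs_sub_abs_le_abs_sub (s k) (-w n k)
    rwa [abs_neg, sub_neg_eq_add] at this
  have h2 : ∑' k, |w n (k + N)| ≤ ∑' k, |(s + w n) (k + N)| + ∑' k, |s (k + N)| := by
    rw [← (lOne_summable_nat_add _ N).tsum_add (lOne_summable_nat_add _ N)]
    refine (lOne_summable_nat_add _ N).tsum_le_tsum (fun k => ?_)
      ((lOne_summable_nat_add _ N).add (lOne_summable_nat_add _ N))
    have := abs_sub (s (k + N) + w n (k + N)) (s (k + N))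
    rwa [add_sub_cancel_left] at this
  linarith

/-- Each coordinate has infimum 0 over S, since otherwise a positive multiple of a unit vector would
be a lower bound. Directedness makes finitely many coordinates small at once below a fixed t in S,
and the tail of t controls the others. -/
theorem lOne_orderContinuousNorm : OrderContinuousNorm (lp (fun _ : ℕ => ℝ) 1) := by
  intro S hne hdir hglb
  have h0 : ∀ s ∈ S, ∀ n, 0 ≤ s n := fun s hs => hglb.1 hs
  have hcoord : ∀ n, ∀ δ > 0, ∃ s ∈ S, s n < δ := by
    intro n δ hδ
    by_contra! hcon
    let e : lp (fun _ : ℕ => ℝ) 1 := lp.single 1 n δ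
    have hn : e n = δ := lp.single_apply_self (E := fun _ : ℕ => ℝ) 1 n δ
    have hlb : e ∈ lowerBounds S := fun s hs k => by
      change e k ≤ s k
      rcases eq_or_ne k n with rfl | hk
      · rw [hn]; exact hcon s hs
      · rw [show e k = 0 from lp.single_apply_ne (E := fun _ : ℕ => ℝ) 1 n δ hk]
        exact h0 s hs k
    have : e n ≤ 0 := hglb.2 hlb n
    rw [hn] at this
    exact absurd hδ (not_lt.2 this)
  have hfin : ∀ δ > 0, ∀ t ∈ S, ∀ N, ∃ s ∈ S, s ≤ t ∧ ∀ n < N, s n < δ := by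
    intro δ hδ t ht N
    induction N with
    | zero => exact ⟨t, ht, le_rfl, fun n hn => absurd hn (Nat.not_lt_zero n)⟩
    | succ N ih =>
      obtain ⟨s, hs, hst, hsN⟩ := ih
      obtain ⟨r, hr, hrN⟩ := hcoord N δ hδ
      obtain ⟨q, hq, hqs, hqr⟩ := hdir s hs r hr
      refine ⟨q, hq, le_trans hqs hst, fun n hn => ?_⟩
      rcases Nat.lt_succ_iff_lt_or_eq.1 hn with h | rfl
      · exact lt_of_le_of_lt (hqs n) (hsN n h)
      · exact lt_of_le_of_lt (hqr n) hrN
  refine tendsto_order.2 ⟨fun a ha => Eventually.of_forall fun s => ha.trans_le (norm_nonneg _),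
    fun ε hε => ?_⟩
  obtain ⟨t, ht⟩ := hne
  obtain ⟨N, hN⟩ := ((lOne_tendsto_tail t).eventually (gt_mem_nhds (half_pos hε))).exists
  obtain ⟨s, hs, hst, hsN⟩ := hfin (ε / 2 / (N + 1)) (by positivity) t ht N
  filter_upwards [Iic_mem_atBot (⟨s, hs⟩ : S)] with r hr
  have hrs : (r : lp (fun _ : ℕ => ℝ) 1) ≤ s := hr
  refine (norm_le_of_nonneg_of_le (hglb.1 r.2) hrs).trans_lt ?_
  rw [lOne_norm_eq_add s N]
  have h1 : ∑ n ∈ Finset.range N, |s n| ≤ ε / 2 := calc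
    ∑ n ∈ Finset.range N, |s n| ≤ ∑ n ∈ Finset.range N, ε / 2 / (N + 1) := by
      refine Finset.sum_le_sum fun n hn => ?_
      rw [abs_of_nonneg (h0 s hs n)]
      exact (hsN n (Finset.mem_range.1 hn)).le
    _ = N * (ε / 2 / (N + 1)) := by rw [Finset.sum_const, Finset.card_range, nsmul_eq_mul]
    _ ≤ ε / 2 := by
      rw [mul_div_assoc', div_le_iff₀ (by positivity)]
      nlinarith
  have h2 : ∑' n, |s (n + N)| ≤ ∑' n, |t (n + N)| := by
    refine (lOne_summable_nat_add _ N).tsum_le_tsum (fun n => ?_) (lOne_summable_nat_add _ N)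
    rw [abs_of_nonneg (h0 s hs _), abs_of_nonneg (h0 t ht _)]
    exact hst _
  linarith

end LOne

/-! ### The dual of c₀, and compactness of operators from c₀ into ℓ₁ -/

section CZero

theorem cZero_abs_apply_le (x : C₀(ℕ, ℝ)) (n : ℕ) : |x n| ≤ ‖x‖ := by
  rw [← ZeroAtInftyContinuousMap.norm_toBCF_eq_norm]
  exact x.toBCF.norm_coe_le_norm n

theorem cZero_norm_le {x : C₀(ℕ, ℝ)} {c : ℝ} (hc : 0 ≤ c) (h : ∀ n, |x n| ≤ c) : ‖x‖ ≤ c := by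
  rw [← ZeroAtInftyContinuousMap.norm_toBCF_eq_norm, BoundedContinuousFunction.norm_le hc]
  exact h

/-- The coordinate functionals on `c₀`. -/
noncomputable def cZeroEval (n : ℕ) : StrongDual ℝ C₀(ℕ, ℝ) :=
  LinearMap.mkContinuous
    { toFun := fun x => x n
      map_add' := fun _ _ => rfl
      map_smul' := fun _ _ => rfl } 1 fun x => by
    rw [one_mul]; exact cZero_abs_apply_le x n

@[simp]
theorem cZeroEval_apply (n : ℕ) (x : C₀(ℕ, ℝ)) : cZeroEval n x = x n := rfl

/-- The unit vectors of `c₀`. -/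
noncomputable def cZeroSingle (n : ℕ) : C₀(ℕ, ℝ) where
  toFun := Pi.single n 1
  continuous_toFun := continuous_of_discreteTopology
  zero_at_infty' := by
    rw [cocompact_eq_cofinite]
    refine tendsto_nhds_of_eventually_eq ?_
    filter_upwards [(Set.finite_singleton n).compl_mem_cofinite] with k hk
    exact Pi.single_eq_of_ne hk _

theorem cZeroSingle_apply (n k : ℕ) : cZeroSingle n k = if k = n then 1 else 0 :=
  Pi.single_apply n 1 k

/-- The projection of `c₀` onto the first `M` coordinates. -/
noncomputable def cZeroTrunc (M : ℕ) : C₀(ℕ, ℝ) →L[ℝ] C₀(ℕ, ℝ) :=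
  ∑ i ∈ Finset.range M, (cZeroEval i).smulRight (cZeroSingle i)

theorem cZeroTrunc_eq_sum (M : ℕ) (x : C₀(ℕ, ℝ)) :
    cZeroTrunc M x = ∑ i ∈ Finset.range M, x i • cZeroSingle i := by
  simp [cZeroTrunc, sum_apply]

theorem cZero_sum_smul_single_apply (M : ℕ) (c : ℕ → ℝ) (n : ℕ) :
    (∑ i ∈ Finset.range M, c i • cZeroSingle i) n = if n < M then c n else 0 := by
  rw [← cZeroEval_apply, map_sum]
  simp [cZeroSingle_apply]

theorem cZeroTrunc_apply (M : ℕ) (x : C₀(ℕ, ℝ)) (n : ℕ) :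
    cZeroTrunc M x n = if n < M then x n else 0 := by
  rw [cZeroTrunc_eq_sum, cZero_sum_smul_single_apply]

theorem tendsto_cZeroTrunc (x : C₀(ℕ, ℝ)) :
    Tendsto (fun M => cZeroTrunc M x) atTop (𝓝 x) := by
  rw [Metric.tendsto_atTop]
  intro ε hε
  have hx := zero_at_infty x
  rw [cocompact_eq_atTop, Metric.tendsto_atTop] at hx
  obtain ⟨N, hN⟩ := hx (ε / 2) (half_pos hε)
  refine ⟨N, fun M hM => lt_of_le_of_lt ?_ (half_lt_self hε)⟩
  rw [dist_eq_norm]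
  refine cZero_norm_le (half_pos hε).le fun n => ?_
  rw [ZeroAtInftyContinuousMap.sub_apply, cZeroTrunc_apply]
  split_ifs with h
  · simpa using (half_pos hε).le
  · have := (hN n (hM.trans (not_lt.1 h))).le
    rw [Real.dist_eq, sub_zero] at this
    rwa [zero_sub, abs_neg]

/-- The sum is the value of f at the finitely supported vector of signs, which lies in the unit
ball. -/
theorem sum_abs_apply_single_le (f : StrongDual ℝ C₀(ℕ, ℝ)) (M : ℕ) :
    ∑ i ∈ Finset.range M, |f (cZeroSingle i)| ≤ ‖f‖ := by
  let u : C₀(ℕ, ℝ) :=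
    ∑ i ∈ Finset.range M, (SignType.sign (f (cZeroSingle i)) : ℝ) • cZeroSingle i
  have hu : ‖u‖ ≤ 1 := cZero_norm_le zero_le_one fun n => by
    rw [cZero_sum_smul_single_apply]
    split_ifs
    · rcases SignType.sign (f (cZeroSingle n)) <;> simp
    · simp
  have hfu : f u = ∑ i ∈ Finset.range M, |f (cZeroSingle i)| := by
    rw [map_sum]
    refine Finset.sum_congr rfl fun i _ => ?_
    rw [map_smul, smul_eq_mul, sign_mul_self]
  rw [← hfu]
  exact (le_abs_self _).trans (f.unit_le_opNorm u hu)

theorem summable_abs_apply_single (f : StrongDual ℝ C₀(ℕ, ℝ)) :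
    Summable fun i => |f (cZeroSingle i)| :=
  summable_of_sum_range_le (fun _ => abs_nonneg _) (sum_abs_apply_single_le f)

theorem norm_eq_tsum_abs_apply_single (f : StrongDual ℝ C₀(ℕ, ℝ)) :
    ‖f‖ = ∑' i, |f (cZeroSingle i)| := by
  refine le_antisymm ?_ (Real.tsum_le_of_sum_range_le (fun _ => abs_nonneg _)
    (sum_abs_apply_single_le f))
  refine f.opNorm_le_bound (tsum_nonneg fun _ => abs_nonneg _) fun x => ?_
  refine le_of_tendsto' ((f.continuous.tendsto x).comp (tendsto_cZeroTrunc x)).norm fun M => ?_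
  rw [Function.comp_apply, cZeroTrunc_eq_sum, map_sum]
  calc ‖∑ i ∈ Finset.range M, f (x i • cZeroSingle i)‖
      ≤ ∑ i ∈ Finset.range M, |f (cZeroSingle i)| * ‖x‖ := by
        refine norm_sum_le_of_le _ fun i _ => ?_
        rw [map_smul, norm_smul, mul_comm]
        exact mul_le_mul_of_nonneg_left (cZero_abs_apply_le x i) (norm_nonneg _)
    _ = (∑ i ∈ Finset.range M, |f (cZeroSingle i)|) * ‖x‖ := by rw [Finset.sum_mul]
    _ ≤ (∑' i, |f (cZeroSingle i)|) * ‖x‖ := by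
        gcongr
        exact (summable_abs_apply_single f).sum_le_tsum _ fun _ _ => abs_nonneg _

/-- The isometry of the dual of `c₀` into `ℓ₁`. -/
noncomputable def cZeroDualToLOne : StrongDual ℝ C₀(ℕ, ℝ) →ₗᵢ[ℝ] lp (fun _ : ℕ => ℝ) 1 where
  toFun f := ⟨fun i => f (cZeroSingle i), memlp_one_iff.2 (summable_abs_apply_single f)⟩
  map_add' _ _ := rfl
  map_smul' _ _ := rfl
  norm_map' f := by
    rw [norm_eq_tsum_abs_apply_single, lOne_norm_eq]
    rfl

/-- On positive functionals the norm agrees with the bounded linear functional σ that sums the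
coordinates, so weak convergence to 0 already contains norm convergence. -/
theorem cZeroDual_positiveSchur : PositiveSchur (StrongDual ℝ C₀(ℕ, ℝ)) := by
  intro f hf hnull
  let σ : StrongDual ℝ (StrongDual ℝ C₀(ℕ, ℝ)) :=
    LinearMap.mkContinuous
      { toFun := fun f => ∑' i, f (cZeroSingle i)
        map_add' := fun f g => (summable_abs_apply_single f).of_abs.tsum_add
          (summable_abs_apply_single g).of_abs
        map_smul' := fun c f => tsum_mul_left } 1 fun f => by
      rw [one_mul, norm_eq_tsum_abs_apply_single]
      exact norm_tsum_le_tsum_norm (summable_abs_apply_single f)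
  refine (hnull σ).congr fun n => ?_
  rw [norm_eq_tsum_abs_apply_single]
  refine tsum_congr fun i => (abs_of_nonneg (hf n _ fun k => ?_)).symm
  change 0 ≤ cZeroSingle i k
  rw [cZeroSingle_apply]
  split_ifs <;> simp

/-- The projection of `c₀` onto the coordinates from `K` on. -/
noncomputable def cZeroTail (K : ℕ) : C₀(ℕ, ℝ) →L[ℝ] C₀(ℕ, ℝ) :=
  ContinuousLinearMap.id ℝ _ - cZeroTrunc K

theorem cZeroTail_apply (K : ℕ) (x : C₀(ℕ, ℝ)) (n : ℕ) :
    cZeroTail K x n = if n < K then 0 else x n := by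
  change x n - cZeroTrunc K x n = _
  rw [cZeroTrunc_apply]
  split_ifs <;> simp

theorem tendsto_norm_comp_cZeroTail (f : StrongDual ℝ C₀(ℕ, ℝ)) :
    Tendsto (fun K => ‖f.comp (cZeroTail K)‖) atTop (𝓝 0) := by
  refine (lOne_tendsto_tail (cZeroDualToLOne f)).congr fun K => ?_
  have hsingle : ∀ i, cZeroTail K (cZeroSingle i) = if i < K then 0 else cZeroSingle i :=
    fun i => by
      ext n
      rw [cZeroTail_apply]
      split_ifs with h1 h2 h2
      · rfl
      · rw [cZeroSingle_apply, if_neg (by omega)]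
      · rw [cZeroSingle_apply, if_neg (by omega)]; rfl
      · rfl
  rw [← cZeroDualToLOne.norm_map, lOne_norm_eq_add _ K, Finset.sum_eq_zero, zero_add]
  · refine tsum_congr fun n => ?_
    change |f (cZeroSingle (n + K))| = |f (cZeroTail K (cZeroSingle (n + K)))|
    rw [hsingle, if_neg (by omega)]
  · intro i hi
    change |f (cZeroTail K (cZeroSingle i))| = 0
    rw [hsingle, if_pos (Finset.mem_range.1 hi), map_zero, abs_zero]

/-- Operators from `c₀` to `ℓ₁` are small on the tails. -/
theorem exists_norm_comp_cZeroTail_le (T : C₀(ℕ, ℝ) →L[ℝ] lp (fun _ : ℕ => ℝ) 1) {ε : ℝ}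
    (hε : 0 < ε) : ∃ K, ‖T.comp (cZeroTail K)‖ ≤ ε := by
  by_contra! hcon
  -- If no tail is small, truncation gives vectors u of the unit ball supported in [K, M) with ‖T u‖
  -- > ε.
  have hex : ∀ K, ∃ u : C₀(ℕ, ℝ), ∃ M, ‖u‖ ≤ 1 ∧ (∀ n < K, u n = 0) ∧ (∀ n ≥ M, u n = 0) ∧
      ε < ‖T u‖ := by
    intro K
    obtain ⟨x, hx1, hx⟩ : ∃ x : C₀(ℕ, ℝ), ‖x‖ = 1 ∧ ε < ‖T (cZeroTail K x)‖ := by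
      by_contra! h
      exact absurd (hcon K) (not_lt.2 (ContinuousLinearMap.opNorm_le_of_unit_norm hε.le h))
    obtain ⟨M, hM⟩ := (((T.continuous.tendsto _).comp
      (tendsto_cZeroTrunc (cZeroTail K x))).norm.eventually (lt_mem_nhds hx)).exists
    refine ⟨cZeroTrunc M (cZeroTail K x), M, cZero_norm_le zero_le_one fun n => ?_, fun n hn => ?_,
      fun n hn => ?_, hM⟩
    · rw [cZeroTrunc_apply, cZeroTail_apply]
      have := cZero_abs_apply_le x n
      rw [hx1] at this
      split_ifs <;> simp [this]
    · rw [cZeroTrunc_apply, cZeroTail_apply, if_pos hn, ite_self]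
    · rw [cZeroTrunc_apply, if_neg (not_lt.2 hn)]
  choose u L hu1 huK huL hTu using hex
  -- Each coordinate of T is a functional on c₀, and such functionals have small tails.
  have hnull : ∀ k, Tendsto (fun K => T (u K) k) atTop (𝓝 0) := fun k => by
    let y : StrongDual ℝ C₀(ℕ, ℝ) :=
      LinearMap.mkContinuous
        { toFun := fun x => T x k
          map_add' := fun x z => by rw [map_add]; rfl
          map_smul' := fun c x => by rw [map_smul]; rfl } ‖T‖ fun x =>
        (lp.norm_apply_le_norm one_ne_zero (T x) k).trans (T.le_opNorm x)
    refine squeeze_zero_norm (fun K => ?_) (tendsto_norm_comp_cZeroTail y)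
    have h1 : cZeroTail K (u K) = u K := by
      ext n
      rw [cZeroTail_apply]
      split_ifs with h
      · exact (huK K n h).symm
      · rfl
    have h2 := (y.comp (cZeroTail K)).unit_le_opNorm (u K) (hu1 K)
    rwa [ContinuousLinearMap.comp_apply, h1] at h2
  -- Gliding hump: adding a disjointly supported block keeps the c₀ norm at most 1, while the ℓ₁
  -- norm of the image grows by at least ε minus the loss ε/2 from imperfect disjointness.
  have hgrow : ∀ n : ℕ, ∃ x : C₀(ℕ, ℝ), ∃ M, ‖x‖ ≤ 1 ∧ (∀ k ≥ M, x k = 0) ∧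
      n * (ε / 2) ≤ ‖T x‖ := by
    intro n
    induction n with
    | zero => exact ⟨0, 0, by simp, fun k _ => rfl, by simp⟩
    | succ n ih =>
      obtain ⟨x, M, hx1, hxM, hx⟩ := ih
      obtain ⟨K, hK, hMK⟩ := ((lOne_eventually_norm_add_ge (T x) hnull (half_pos hε)).and
        (eventually_ge_atTop M)).exists
      refine ⟨x + u K, max M (L K), cZero_norm_le zero_le_one fun k => ?_, fun k hk => ?_, ?_⟩
      · rw [ZeroAtInftyContinuousMap.add_apply]
        rcases lt_or_ge k K with h | h
        · rw [huK K k h, add_zero]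
          exact (cZero_abs_apply_le x k).trans hx1
        · rw [hxM k (hMK.trans h), zero_add]
          exact (cZero_abs_apply_le (u K) k).trans (hu1 K)
      · rw [ZeroAtInftyContinuousMap.add_apply, hxM k ((le_max_left _ _).trans hk),
          huL K k ((le_max_right _ _).trans hk), add_zero]
      · rw [map_add]
        push_cast
        linarith [hTu K]
  obtain ⟨n, hn⟩ := exists_nat_gt (‖T‖ / (ε / 2))
  obtain ⟨x, M, hx1, -, hx⟩ := hgrow n
  rw [div_lt_iff₀ (half_pos hε)] at hn
  exact absurd (hn.trans_le hx) (not_lt.2 (T.unit_le_opNorm x hx1))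

theorem IsCompactOperator.isWeaklyCompactOp {G H : Type*} [NormedAddCommGroup G] [NormedSpace ℝ G]
    [NormedAddCommGroup H] [NormedSpace ℝ H] {T : G →L[ℝ] H} (hT : IsCompactOperator T) :
    IsWeaklyCompactOp T := by
  obtain ⟨K, hK, hTK⟩ := hT.image_closedBall_subset_compact (f := T.toLinearMap) 1
  refine (hK.image (toWeakSpaceCLM ℝ H).continuous).closure_of_subset ?_
  rintro _ ⟨x, hx, rfl⟩
  exact ⟨T x, hTK ⟨x, hx, rfl⟩, rfl⟩

/-- T is the norm limit of the finite rank operators T ∘ `cZeroTrunc K`, hence compact. Allowing any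
X embedded in ℓ₁ covers both c₀*, which gives Arens regularity, and ℓ₁ itself. -/
theorem isWeaklyCompactOp_of_linearIsometry_lOne {X : Type*} [NormedAddCommGroup X]
    [NormedSpace ℝ X] [CompleteSpace X] (ι : X →ₗᵢ[ℝ] lp (fun _ : ℕ => ℝ) 1)
    (T : C₀(ℕ, ℝ) →L[ℝ] X) : IsWeaklyCompactOp T := by
  refine IsCompactOperator.isWeaklyCompactOp ?_
  have hfin : ∀ K, IsCompactOperator (T.comp (cZeroTrunc K)) := fun K => by
    have h : IsCompactOperator (cZeroTrunc K) :=
      (compactOperator (RingHom.id ℝ) C₀(ℕ, ℝ) C₀(ℕ, ℝ)).sum_mem fun i _ =>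
        IsCompactOperator.clm_comp (f := (cZeroEval i).toLinearMap)
          (isCompactOperator_of_locallyCompactSpace_dom (cZeroEval i))
          ((ContinuousLinearMap.id ℝ ℝ).smulRight (cZeroSingle i))
    exact h.clm_comp T
  have hmem : T ∈ closure {S : C₀(ℕ, ℝ) →L[ℝ] X | IsCompactOperator S} := by
    refine Metric.mem_closure_iff.2 fun ε hε => ?_
    obtain ⟨K, hK⟩ := exists_norm_comp_cZeroTail_le (ι.toContinuousLinearMap.comp T) (half_pos hε)
    refine ⟨_, hfin K, lt_of_le_of_lt ?_ (half_lt_self hε)⟩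
    have h1 : T - T.comp (cZeroTrunc K) = T.comp (cZeroTail K) := by
      rw [cZeroTail, ContinuousLinearMap.comp_sub, ContinuousLinearMap.comp_id]
    rw [dist_eq_norm, h1]
    rwa [ContinuousLinearMap.comp_assoc, LinearIsometry.norm_toContinuousLinearMap_comp] at hK
  rwa [isClosed_setOfPred_isCompactOperator.closure_eq] at hmem

theorem cZero_arensRegular : ArensRegular C₀(ℕ, ℝ) :=
  isWeaklyCompactOp_of_linearIsometry_lOne cZeroDualToLOne

end CZero

end BanachLattice

theorem corollary2p5 :
    (∀ (E : Type u) (F : Type v)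
      [NormedAddCommGroup E] [NormedSpace ℝ E] [CompleteSpace E] [Lattice E] [HasSolidNorm E]
      [IsOrderedAddMonoid E] [IsOrderedModule ℝ E]
      [NormedAddCommGroup F] [NormedSpace ℝ F] [CompleteSpace F] [Lattice F] [HasSolidNorm F]
      [IsOrderedAddMonoid F] [IsOrderedModule ℝ F],
      ArensRegular E → PositiveSchur (StrongDual ℝ E) → OrderContinuousNorm F →
      (∀ T : E →L[ℝ] F, IsWeaklyCompactOp T) →
      ∀ (m : ℕ) (A : MultilinearMap ℝ (fun _ : Fin m => E) F), PositiveMultilinear A →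
        ∃ hA : Continuous A, ∀ ρ : Equiv.Perm (Fin m),
          SeparatelyAlmostDunfordPettis (aronBerner ρ ⟨A, hA⟩).toMultilinearMap) ∧
    (ArensRegular C₀(ℕ, ℝ) ∧ PositiveSchur (StrongDual ℝ C₀(ℕ, ℝ)) ∧
      OrderContinuousNorm (lp (fun _ : ℕ => ℝ) 1) ∧
      (∀ T : C₀(ℕ, ℝ) →L[ℝ] lp (fun _ : ℕ => ℝ) 1, IsWeaklyCompactOp T) ∧
      ∀ (m : ℕ) (A : MultilinearMap ℝ (fun _ : Fin m => C₀(ℕ, ℝ)) (lp (fun _ : ℕ => ℝ) 1)),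
        PositiveMultilinear A →
        ∃ hA : Continuous A, ∀ ρ : Equiv.Perm (Fin m),
          SeparatelyAlmostDunfordPettis (aronBerner ρ ⟨A, hA⟩).toMultilinearMap) := by
  refine ⟨fun E F => ?_, cZero_arensRegular, cZeroDual_positiveSchur, lOne_orderContinuousNorm,
    isWeaklyCompactOp_of_linearIsometry_lOne LinearIsometry.id, fun m A hA => ?_⟩
  · intro _ _ _ _ _ _ _ _ _ _ _ _ _ _ hE hE' hF hEF m A hA
    exact ⟨hA.continuous, hA.separatelyAlmostDunfordPettis hE hE' hF hEF⟩
  · exact ⟨hA.continuous, hA.separatelyAlmostDunfordPettis cZero_arensRegular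
      cZeroDual_positiveSchur lOne_orderContinuousNorm
      (isWeaklyCompactOp_of_linearIsometry_lOne LinearIsometry.id)⟩
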